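/- Conventions. A meromorphic function $f:\mathbb C\to\widehat{\mathbb C}$ with an essential singularity at $\infty$ is called general transcendental meromorphic if it has at least two poles, or exactly one pole and that pole is not an omitted value. Iterates $f^n$ are defined at $z$ as long as the orbit of $z$ has not met $\infty$ before; for $A\subset\mathbb C$, $f^{-n}(A)$ is the set of $z\in\mathbb C$ at which $f^n$ is defined with $f^n(z)\in A$. The Fatou set $\mathcal F(f)$ is the set of points of $\mathbb C$ having a neighbourhood on which all $f^n$ are defined and form a normal family (with respect to the spherical metric); its connected components are the Fatou components. A value $b\in\mathbb C$ with $f(z)\ne b$ for all $z\in\mathbb C$ is a Baker omitted value (bov) if there is $r_0>0$ such that for every $0<r<r_0$ each connected component of the boundary (in $\mathbb C$) of $f^{-1}(\{|w-b|<r\})$ is bounded; it is stable if all iterates $f^n$ are defined on some neighbourhood of $b$. Let $\mathcal M_S$ be the class of general transcendental meromorphic functions with a stable bov. For $p\ge1$, a $p$-periodic rotation domain of $f$ is a Fatou component $D$ with $f^p(D)\subseteq D$ for which there are an irrational $\theta\in\mathbb R$ and a conformal bijection $\phi$ from $D$ onto the unit disk $\{|z|<1\}$ (Siegel disk) or onto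 an annulus $\{1<|z|<r\}$, $1<r<\infty$ (Herman ring), with $\phi(f^p(z))=e^{2\pi i\theta}\phi(z)$ for $z\in D$. A repelling $p$-periodic point is a point $z_0\in\mathbb C$ at which $f^p$ is defined, with $f^p(z_0)=z_0$ and $|(f^p)'(z_0)|>1$. (In both cases $p$ need not be the least period.) Theorem. Let $f\in\mathcal M_S$, let $p\ge 1$, and let $D$ be a $p$-periodic rotation domain of $f$. If the boundary $\partial D$ contains a repelling $p$-periodic point $z_0$, then for each $k\ge1$ there is a connected component $D_{-k}$ of $f^{-pk}(D)$, different from $D$, such that $z_0\in\partial D_{-k}$. -/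

import Mathlib

/-- `z` is a pole of `f`. -/
def IsPole (f : ℂ → ℂ) (z : ℂ) : Prop := meromorphicOrderAt f z < 0

/-- Meromorphic functions on the whole plane, i.e. holomorphic maps from `ℂ` to the Riemann sphere.
Such a map is represented by its normal form `f : ℂ → ℂ`: it is analytic at every point which is not
a pole, and a pole is a point at which the sphere-valued map is `∞`. The number which `f` takes at a
pole (Mathlib's convention is `0`) is never used below: each definition treats poles separately. -/
def IsMeromorphicOnPlane (f : ℂ → ℂ) : Prop := MeromorphicNFOn f Set.univ

/-- General transcendental meromorphic functions: meromorphic on `ℂ`, with an essential singularity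
at `∞` (which may be a limit of poles), and having either at least two poles, or exactly one pole
which is not an omitted value. -/
structure IsGeneralTranscendental (f : ℂ → ℂ) : Prop where
  meromorphic : IsMeromorphicOnPlane f
  essential : ¬ MeromorphicAt (fun z => f z⁻¹) 0
  poles : {z | IsPole f z}.Nontrivial ∨
    ∃ a, {z | IsPole f z} = {a} ∧ ∃ z, ¬ IsPole f z ∧ f z = a

/-- The preimage `f⁻ⁿ(A)` of a set `A ⊆ ℂ`: the points at which `fⁿ` is defined and finite, with
value in `A`. -/
def iterPreimage (f : ℂ → ℂ) (n : ℕ) (A : Set ℂ) : Set ℂ :=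
  {z | (∀ i < n, ¬ IsPole f (f^[i] z)) ∧ f^[n] z ∈ A}

/-- All iterates of `f` are defined (and hence finite) at each point of `V`: no orbit starting in `V`
meets a pole. -/
def IteratesDefinedOn (f : ℂ → ℂ) (V : Set ℂ) : Prop :=
  ∀ z ∈ V, ∀ n : ℕ, ¬ IsPole f (f^[n] z)

/-- `C` is a connected component of the set `S`. -/
def IsComponentOf (C S : Set ℂ) : Prop := ∃ z ∈ S, C = connectedComponentIn S z

/-- `b` is an omitted value: no point of `ℂ` is mapped to `b`. -/
def IsOmittedValue (f : ℂ → ℂ) (b : ℂ) : Prop := ∀ z, ¬ IsPole f z → f z ≠ b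

/-- `b` is a Baker omitted value: an omitted value such that, for every sufficiently small disk
centred at `b`, each component of the boundary of the preimage of that disk is bounded. -/
def IsBakerOmittedValue (f : ℂ → ℂ) (b : ℂ) : Prop :=
  IsOmittedValue f b ∧
    ∃ r₀ : ℝ, 0 < r₀ ∧ ∀ r : ℝ, 0 < r → r < r₀ →
      ∀ C, IsComponentOf C (frontier (iterPreimage f 1 (Metric.ball b r))) → Bornology.IsBounded C

/-- The Baker omitted value `b` is stable: all iterates are defined in a neighbourhood of `b`. -/
def IsStableBakerOmittedValue (f : ℂ → ℂ) (b : ℂ) : Prop :=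
  IsBakerOmittedValue f b ∧ ∃ V, IsOpen V ∧ b ∈ V ∧ IteratesDefinedOn f V

/-- The class of general transcendental meromorphic functions with a stable Baker omitted value. -/
def ClassMS (f : ℂ → ℂ) : Prop :=
  IsGeneralTranscendental f ∧ ∃ b, IsStableBakerOmittedValue f b

/-- The chordal metric of the Riemann sphere. -/
noncomputable def chordalDist : OnePoint ℂ → OnePoint ℂ → ℝ
  | OnePoint.some z, OnePoint.some w => 2 * ‖z - w‖ / (√(1 + ‖z‖ ^ 2) * √(1 + ‖w‖ ^ 2))
  | OnePoint.some z, OnePoint.infty => 2 / √(1 + ‖z‖ ^ 2)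
  | OnePoint.infty, OnePoint.some w => 2 / √(1 + ‖w‖ ^ 2)
  | OnePoint.infty, OnePoint.infty => 0

/-- The family of iterates is normal on `V` in the sense of Montel: each sequence of iterates has
a subsequence which converges, uniformly on compact subsets of `V` in the chordal metric, to some
map into the Riemann sphere. -/
def NormalIteratesOn (f : ℂ → ℂ) (V : Set ℂ) : Prop :=
  ∀ u : ℕ → ℕ, ∃ s : ℕ → ℕ, StrictMono s ∧ ∃ g : ℂ → OnePoint ℂ,
    ∀ K, IsCompact K → K ⊆ V → ∀ ε : ℝ, 0 < ε →
      ∀ᶠ k in Filter.atTop, ∀ z ∈ K, chordalDist ((f^[u (s k)] z : ℂ) : OnePoint ℂ) (g z) < ε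

/-- The Fatou set: points having a neighbourhood in which all iterates are defined and form
a normal family. -/
def fatouSet (f : ℂ → ℂ) : Set ℂ :=
  {z | ∃ V, IsOpen V ∧ z ∈ V ∧ IteratesDefinedOn f V ∧ NormalIteratesOn f V}

/-- Fatou components: connected components of the Fatou set. -/
def IsFatouComponent (f : ℂ → ℂ) (D : Set ℂ) : Prop := IsComponentOf D (fatouSet f)

/-- `D` is a `p`-periodic Fatou component: the Fatou component containing `f^p(D)` is `D`. As in
the definition `D_p ⊆ D`, the number `p` need not be the least period. -/
def IsPeriodicFatouComponent (f : ℂ → ℂ) (p : ℕ) (D : Set ℂ) : Prop :=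
  1 ≤ p ∧ IsFatouComponent f D ∧ Set.MapsTo f^[p] D D

/-- `f^p` is conjugate on `D`, by a conformal bijection from `D` onto `T`, to an irrational
rotation about the origin. -/
def ConjugateToIrrationalRotation (f : ℂ → ℂ) (p : ℕ) (D T : Set ℂ) : Prop :=
  ∃ φ : ℂ → ℂ, DifferentiableOn ℂ φ D ∧ Set.BijOn φ D T ∧
    ∃ θ : ℝ, Irrational θ ∧
      ∀ z ∈ D, φ (f^[p] z) = Complex.exp (2 * Real.pi * Complex.I * θ) * φ z

/-- `p`-periodic Siegel disks. -/
def IsSiegelDisk (f : ℂ → ℂ) (p : ℕ) (D : Set ℂ) : Prop :=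
  IsPeriodicFatouComponent f p D ∧
    ConjugateToIrrationalRotation f p D {z | ‖z‖ < 1}

/-- `p`-periodic Herman rings. -/
def IsHermanRing (f : ℂ → ℂ) (p : ℕ) (D : Set ℂ) : Prop :=
  IsPeriodicFatouComponent f p D ∧
    ∃ r : ℝ, 1 < r ∧ ConjugateToIrrationalRotation f p D {z | 1 < ‖z‖ ∧ ‖z‖ < r}

/-- `p`-periodic rotation domains: Siegel disks and Herman rings. -/
def IsRotationDomain (f : ℂ → ℂ) (p : ℕ) (D : Set ℂ) : Prop :=
  IsSiegelDisk f p D ∨ IsHermanRing f p D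

/-- `z₀` is a repelling `p`-periodic point: `f^p` is defined at `z₀`, `f^p(z₀) = z₀`, and the
multiplier has modulus greater than one. The number `p` need not be the least period. -/
def IsRepellingPeriodicPoint (f : ℂ → ℂ) (p : ℕ) (z₀ : ℂ) : Prop :=
  1 ≤ p ∧ (∀ i < p, ¬ IsPole f (f^[i] z₀)) ∧ f^[p] z₀ = z₀ ∧ 1 < ‖deriv f^[p] z₀‖

/-!
Write `F` for the Fatou set, `b` for the stable Baker omitted value, and let `f ^ p` act on the
rotation domain `D` with a repelling fixed point `z₀ ∈ ∂D`.

*Where the points come from.* Arbitrarily close to `z₀` there are points outside `D` which `f ^ p`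
maps into `D` (`frequently_notMem_of_repelling`). Otherwise the local inverse of `f ^ p` at `z₀`, a
contraction towards `z₀`, would keep a point of `D` near `z₀` inside `D` forever; its backward orbit
tends to `z₀`, yet in the linearizing coordinate it stays on one circle, hence in a compact subset
of `D`.

*Why they lie in one component.* It suffices that near a point `ζ` only finitely many components of
`f⁻¹(U)` are relevant, for the domains `U` that occur (`exists_finite_meeting_components`): the
pigeonhole principle, applied once for each of the `p` steps of the cycle of `z₀`, then gives a
component of `f ^ (-p)(D)` which contains such points arbitrarily close to `z₀`. As
`f ^ p (D) ⊆ D`, this component lies in one of `f ^ (-pk)(D)` for each `k ≥ 1`.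

*Finiteness.* The function `g = 1 / (f - b)` is entire, and `f⁻¹(B(b, r))` is `{|g| > 1 / r}`. By
the maximum principle the components of this set are unbounded. A plane set whose frontier has only
bounded components cannot contain an unbounded connected set and have another one in its complement
(`false_of_unbounded_of_frontier_components_bounded`), so all components of `{|g| ≤ 1 / r}` are
bounded. Over a domain which avoids the closed disc about `b`, the map `f` is therefore proper on
each component of the preimage, so each component contains a point of a given fibre, and a compact
set contains only finitely many points of that fibre. A domain `U` which contains `b` is first
punctured by a closed disc; only `b ∈ ∂U` has to be excluded.

*The omitted value is not on the frontier.* The iterates on a neighbourhood of `b` omit `b`, a pole,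
and `∞`, so by Montel's theorem `b ∈ F`, whereas no `U` has a frontier point in `F`
(`IsFatouDomain`). Montel's theorem for two omitted finite values is not in Mathlib; it is obtained
here from Bloch's theorem (`exists_ball_subset_image`) by way of Schottky's (`schottky`).
-/

open Set Filter Topology Metric

/-! ### Plane topology: sets with bounded frontier components -/

/-- In a closed plane set, a point with bounded component has a compact relatively open
neighbourhood: inside a large disc the component is an intersection of relatively clopen sets, one
of which avoids the bounding circle. -/
lemma exists_compact_clopen_nhd {X : Set ℂ} (hX : IsClosed X) {x : ℂ} (hx : x ∈ X)
    (hb : Bornology.IsBounded (connectedComponentIn X x)) :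
    ∃ O : Set ℂ, IsOpen O ∧ x ∈ O ∧ IsCompact (X ∩ O) := by
  obtain ⟨ρ, hρ⟩ := hb.subset_ball 0
  set Y : Set ℂ := X ∩ closedBall 0 ρ with hY
  have hYc : IsCompact Y := (isCompact_closedBall 0 ρ).inter_left hX
  have : CompactSpace Y := isCompact_iff_compactSpace.1 hYc
  have hxρ : x ∈ ball (0 : ℂ) ρ := hρ (mem_connectedComponentIn hx)
  let y : Y := ⟨x, hx, ball_subset_closedBall hxρ⟩
  have hcomp : connectedComponent y ⊆ Subtype.val ⁻¹' ball (0 : ℂ) ρ := by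
    intro w hw
    apply hρ
    have h1 : IsPreconnected (Subtype.val '' connectedComponent y) :=
      isPreconnected_connectedComponent.image _ continuous_subtype_val.continuousOn
    refine h1.subset_connectedComponentIn ⟨y, mem_connectedComponent, rfl⟩ ?_ ⟨w, hw, rfl⟩
    rintro _ ⟨v, -, rfl⟩
    exact v.2.1
  rw [connectedComponent_eq_iInter_isClopen] at hcomp
  have hopen : IsOpen (Subtype.val ⁻¹' ball (0 : ℂ) ρ : Set Y) :=
    isOpen_ball.preimage continuous_subtype_val
  have : Nonempty { s : Set Y // IsClopen s ∧ y ∈ s } := ⟨⟨univ, isClopen_univ, mem_univ _⟩⟩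
  obtain ⟨⟨Z, hZ, hyZ⟩, hZρ⟩ := exists_subset_nhds_of_compactSpace
    (V := fun s : { s : Set Y // IsClopen s ∧ y ∈ s } => (s : Set Y))
    (by
      intro s t
      exact ⟨⟨s.1 ∩ t.1, s.2.1.inter t.2.1, s.2.2, t.2.2⟩, inter_subset_left, inter_subset_right⟩)
    (fun s => s.2.1.isClosed) (fun w hw => hopen.mem_nhds (hcomp hw))
  obtain ⟨O, hO, hOZ⟩ := isOpen_induced_iff.1 hZ.isOpen
  refine ⟨O ∩ ball 0 ρ, hO.inter isOpen_ball, ⟨?_, hxρ⟩, ?_⟩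
  · have : y ∈ Subtype.val ⁻¹' O := by rw [hOZ]; exact hyZ
    exact this
  · have : X ∩ (O ∩ ball 0 ρ) = Subtype.val '' Z := by
      ext w
      constructor
      · rintro ⟨h1, h2, h3⟩
        refine ⟨⟨w, h1, ball_subset_closedBall h3⟩, ?_, rfl⟩
        rw [← hOZ]; exact h2
      · rintro ⟨v, hv, rfl⟩
        exact ⟨v.2.1, by rw [← hOZ] at hv; exact hv, hZρ hv⟩
    rw [this]
    exact hZ.isClosed.isCompact.image continuous_subtype_val

lemma exists_compact_clopen_superset {X : Set ℂ} (hX : IsClosed X)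
    (hb : ∀ x ∈ X, Bornology.IsBounded (connectedComponentIn X x)) {K : Set ℂ} (hK : IsCompact K) :
    ∃ O : Set ℂ, IsOpen O ∧ X ∩ K ⊆ O ∧ IsCompact (X ∩ O) := by
  refine (hK.inter_left hX).induction_on
    (p := fun s => ∃ O : Set ℂ, IsOpen O ∧ s ⊆ O ∧ IsCompact (X ∩ O)) ?_ ?_ ?_ ?_
  · exact ⟨∅, isOpen_empty, Subset.rfl, by simp⟩
  · rintro s t hst ⟨O, h1, h2, h3⟩
    exact ⟨O, h1, hst.trans h2, h3⟩
  · rintro s t ⟨O, h1, h2, h3⟩ ⟨O', h1', h2', h3'⟩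
    exact ⟨O ∪ O', h1.union h1', union_subset_union h2 h2', by
      rw [inter_union_distrib_left]; exact h3.union h3'⟩
  · intro x hx
    obtain ⟨O, h1, h2, h3⟩ := exists_compact_clopen_nhd hX hx.1 (hb x hx.1)
    exact ⟨O, mem_nhdsWithin_of_mem_nhds (h1.mem_nhds h2), O, h1, Subset.rfl, h3⟩

/-- A continuous logarithm of `1` on a connected set is constant; thus two continuous logarithms of
the same function differ by a constant. -/
lemma IsPreconnected.eq_of_exp_eq_one {S : Set ℂ} (hS : IsPreconnected S) {h : ℂ → ℂ}
    (hc : ContinuousOn h S) (he : ∀ z ∈ S, Complex.exp (h z) = 1) {x y : ℂ} (hx : x ∈ S)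
    (hy : y ∈ S) : h x = h y := by
  have key : ∀ z ∈ S, ∃ n : ℤ, h z = n * (2 * Real.pi * Complex.I) := fun z hz =>
    Complex.exp_eq_one_iff.1 (he z hz)
  have him : ∀ z ∈ S, ∀ n : ℤ, h z = n * (2 * Real.pi * Complex.I) →
      (h z).im = n * (2 * Real.pi) := by
    intro z _ n hn
    rw [hn]; simp
  have hpi := Real.pi_pos
  obtain ⟨n, hn⟩ := key x hx
  obtain ⟨m, hm⟩ := key y hy
  have hconn : IsPreconnected ((fun z => (h z).im) '' S) :=
    hS.image _ (Complex.continuous_im.comp_continuousOn hc)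
  -- a connected set of integer multiples of `2π` contains no half-integer multiple
  have hlt : ∀ u ∈ S, ∀ v ∈ S, ∀ k l : ℤ, h u = k * (2 * Real.pi * Complex.I) →
      h v = l * (2 * Real.pi * Complex.I) → ¬ k < l := by
    intro u hu v hv k l hk hl hkl
    have h1 : (k : ℝ) + 1 ≤ l := by exact_mod_cast hkl
    have := hconn.Icc_subset ⟨u, hu, rfl⟩ ⟨v, hv, rfl⟩
    obtain ⟨w, hw, hw'⟩ := this (a := ((k : ℝ) + 1 / 2) * (2 * Real.pi))
      ⟨by simp only [him u hu k hk]; nlinarith, by simp only [him v hv l hl]; nlinarith⟩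
    obtain ⟨j, hj⟩ := key w hw
    simp only [him w hw j hj] at hw'
    have h2 : (j : ℝ) = k + 1 / 2 := mul_right_cancel₀ (by positivity) hw'
    have h3 : ((2 * j : ℤ) : ℝ) = ((2 * k + 1 : ℤ) : ℝ) := by push_cast; linarith
    have h4 : 2 * j = 2 * k + 1 := by exact_mod_cast h3
    omega
  have : n = m :=
    le_antisymm (not_lt.1 (hlt y hy x hx m n hm hn)) (not_lt.1 (hlt x hx y hy n m hn hm))
  rw [hn, hm, this]

lemma isPreconnected_setOf_lt_norm (ρ : ℝ) :
    IsPreconnected {z : ℂ | ρ < ‖z‖} := by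
  by_cases hρ : ρ < 0
  · have : {z : ℂ | ρ < ‖z‖} = univ := eq_univ_of_forall fun z => hρ.trans_le (norm_nonneg z)
    rw [this]; exact isPreconnected_univ
  · push Not at hρ
    have : {z : ℂ | ρ < ‖z‖} = Complex.exp '' {w : ℂ | ρ < Real.exp w.re} := by
      ext z
      constructor
      · intro hz
        have hz0 : z ≠ 0 := by
          rintro rfl; simp at hz; linarith
        refine ⟨Complex.log z, ?_, Complex.exp_log hz0⟩
        simp only [mem_ofPred_eq, ← Complex.norm_exp, Complex.exp_log hz0]; exact hz
      · rintro ⟨w, hw, rfl⟩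
        simpa [Complex.norm_exp] using hw
    rw [this]
    refine IsPreconnected.image ?_ _ Complex.continuous_exp.continuousOn
    rcases hρ.eq_or_lt with rfl | hρ
    · simp [Real.exp_pos, isPreconnected_univ]
    · have : {w : ℂ | ρ < Real.exp w.re} = {w : ℂ | Real.log ρ < w.re} := by
        ext w; simp [Real.log_lt_iff_lt_exp hρ]
      rw [this]
      exact (convex_halfSpace_re_gt _).isPreconnected

lemma isPreconnected_annulus (b : ℂ) {r R : ℝ} (hr : 0 < r) (hR : 0 < R) :
    IsPreconnected {z : ℂ | r < ‖z - b‖ ∧ ‖z - b‖ < R} := by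
  have : {z : ℂ | r < ‖z - b‖ ∧ ‖z - b‖ < R} =
      (fun w => b + Complex.exp w) '' {w : ℂ | Real.log r < w.re ∧ w.re < Real.log R} := by
    ext z
    constructor
    · rintro ⟨h1, h2⟩
      have hz0 : z - b ≠ 0 := norm_pos_iff.1 (hr.trans h1)
      refine ⟨Complex.log (z - b), ⟨?_, ?_⟩, by simp [Complex.exp_log hz0]⟩
      · rw [Complex.log_re]; exact Real.log_lt_log hr h1
      · rw [Complex.log_re]; exact Real.log_lt_log (hr.trans h1) h2
    · rintro ⟨w, ⟨h1, h2⟩, rfl⟩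
      simp only [mem_ofPred_eq, add_sub_cancel_left, Complex.norm_exp]
      exact ⟨(Real.log_lt_iff_lt_exp hr).1 h1, (Real.lt_log_iff_exp_lt hR).1 h2⟩
  rw [this]
  refine IsPreconnected.image ?_ _ (by fun_prop)
  exact ((convex_halfSpace_re_gt _).inter (convex_halfSpace_re_lt _)).isPreconnected

lemma isPreconnected_diff_closedBall {U : Set ℂ} (hU : IsOpen U) (hc : IsPreconnected U) {b : ℂ}
    {r : ℝ} (hr : 0 < r) (hsub : closedBall b r ⊆ U) : IsPreconnected (U \ closedBall b r) := by
  obtain ⟨δ, hδ, hδU⟩ := (isCompact_closedBall b r).exists_thickening_subset_open hU hsub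
  rw [thickening_closedBall hδ hr.le] at hδU
  have hann := isPreconnected_annulus b hr (show 0 < δ + r by positivity)
  set N : Set ℂ := {z : ℂ | r < ‖z - b‖ ∧ ‖z - b‖ < δ + r} with hN
  have hNU : N ⊆ U \ closedBall b r := by
    rintro z ⟨h1, h2⟩
    refine ⟨hδU (by rwa [mem_ball, dist_eq_norm]), ?_⟩
    rw [mem_closedBall, dist_eq_norm]; exact not_le.2 h1
  have hNne : N.Nonempty := by
    refine ⟨b + ((r + δ / 2 : ℝ) : ℂ), ?_⟩
    simp only [hN, mem_ofPred_eq, add_sub_cancel_left, Complex.norm_real, Real.norm_eq_abs]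
    rw [abs_of_pos (by positivity)]
    constructor <;> linarith
  have hU' : IsOpen (U \ closedBall b r) := hU.sdiff isClosed_closedBall
  rw [isPreconnected_iff_subset_of_disjoint] at hann ⊢
  -- the part containing the annulus, together with the disc, is open
  have main : ∀ P Q : Set ℂ, IsOpen P → IsOpen Q → U \ closedBall b r ⊆ P ∪ Q →
      (U \ closedBall b r) ∩ (P ∩ Q) = ∅ → N ⊆ P → U \ closedBall b r ⊆ P := by
    intro P Q hP hQ hPQ hd hNP
    have hP' : IsOpen (((U \ closedBall b r) ∩ P) ∪ ball b (δ + r)) :=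
      (hU'.inter hP).union isOpen_ball
    have hQ' : IsOpen ((U \ closedBall b r) ∩ Q) := hU'.inter hQ
    have hdisj : U ∩ ((((U \ closedBall b r) ∩ P) ∪ ball b (δ + r)) ∩ ((U \ closedBall b r) ∩ Q))
        = ∅ := by
      rw [eq_empty_iff_forall_notMem]
      rintro z ⟨-, h1, h2, h3⟩
      have h4 : z ∈ P := by
        rcases h1 with h1 | h1
        · exact h1.2
        · refine hNP ⟨?_, ?_⟩
          · have := h2.2
            rw [mem_closedBall, dist_eq_norm] at this
            exact not_le.1 this
          · rwa [mem_ball, dist_eq_norm] at h1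
      have : z ∈ (U \ closedBall b r) ∩ (P ∩ Q) := ⟨h2, h4, h3⟩
      rw [hd] at this
      exact this
    have hcov : U ⊆ (((U \ closedBall b r) ∩ P) ∪ ball b (δ + r)) ∪ ((U \ closedBall b r) ∩ Q) := by
      intro z hz
      by_cases hzb : z ∈ closedBall b r
      · exact Or.inl (Or.inr (closedBall_subset_ball (by linarith) hzb))
      · rcases hPQ ⟨hz, hzb⟩ with h | h
        · exact Or.inl (Or.inl ⟨⟨hz, hzb⟩, h⟩)
        · exact Or.inr ⟨⟨hz, hzb⟩, h⟩
    rcases isPreconnected_iff_subset_of_disjoint.1 hc _ _ hP' hQ' hcov hdisj with h | h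
    · rintro z hz
      rcases h hz.1 with h | h
      · exact h.2
      · refine hNP ⟨?_, by rwa [mem_ball, dist_eq_norm] at h⟩
        have := hz.2
        rw [mem_closedBall, dist_eq_norm] at this
        exact not_le.1 this
    · have : b ∈ U := hsub (mem_closedBall_self hr.le)
      exact absurd (mem_closedBall_self hr.le) (h this).1.2
  intro P Q hP hQ hPQ hd
  have hNd : N ∩ (P ∩ Q) = ∅ := subset_empty_iff.1 (hd ▸ inter_subset_inter_left _ hNU)
  rcases hann P Q hP hQ (hNU.trans hPQ) hNd with h | h
  · exact Or.inl (main P Q hP hQ hPQ hd h)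
  · exact Or.inr (main Q P hQ hP (by rwa [union_comm]) (by rwa [inter_comm Q P]) h)

/-- If all components of the frontier of a plane set `A` are bounded, then `A` and its complement
cannot both contain an unbounded connected set.

Choose a cut-off `l` with values `0` near the origin and `1` near infinity, and with values only `0`
and `1` on the frontier of `A`. The function which is `exp (2πi l)` on `A` and `1` off `A` is then
continuous on the plane, hence has a continuous logarithm `θ`. Going from the origin to infinity,
`θ` changes by `2πi` along `S` and not at all along `T`. -/
theorem false_of_unbounded_of_frontier_components_bounded {A : Set ℂ}
    (hA : ∀ x ∈ frontier A, Bornology.IsBounded (connectedComponentIn (frontier A) x))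
    {S T : Set ℂ} (hS : IsPreconnected S) (hT : IsPreconnected T) (hSA : S ⊆ A) (hTA : Disjoint T A)
    (hSne : S.Nonempty) (hTne : T.Nonempty)
    (hSb : ¬ Bornology.IsBounded S) (hTb : ¬ Bornology.IsBounded T) : False := by
  classical
  obtain ⟨s, hs⟩ := hSne
  obtain ⟨t, ht⟩ := hTne
  set R : ℝ := max ‖s‖ ‖t‖
  obtain ⟨O, hO, hXO, hE⟩ := exists_compact_clopen_superset isClosed_frontier hA
    (isCompact_closedBall (0 : ℂ) R)
  obtain ⟨ρ, hρ⟩ := (hE.union (isCompact_closedBall (0 : ℂ) R)).isBounded.subset_ball 0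
  -- a cut-off which takes only the values `0` and `1` on the frontier of `A`
  obtain ⟨l, hl0, hl1, -⟩ := exists_continuous_zero_one_of_isClosed
    (hE.isClosed.union (isClosed_closedBall (x := (0 : ℂ)) (ε := R)))
    ((isClosed_frontier (s := A)).sdiff hO |>.union
      (isClosed_le continuous_const continuous_norm : IsClosed {z : ℂ | ρ ≤ ‖z‖}))
    (by
      rw [Set.disjoint_left]
      rintro z hz (h | h)
      · rcases hz with hz | hz
        · exact h.2 hz.2
        · exact h.2 (hXO ⟨h.1, hz⟩)
      · have := hρ hz
        rw [mem_ball_zero_iff] at this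
        exact absurd h (not_le.2 this))
  set c : ℂ := 2 * Real.pi * Complex.I with hc
  have hexpc : Complex.exp c = 1 := Complex.exp_two_pi_mul_I
  set φ : ℂ → ℂ := fun z => if z ∈ A then Complex.exp (l z * c) else 1 with hφ
  have hφc : Continuous φ := by
    refine Continuous.if ?_ (by fun_prop) continuous_const
    intro z hz
    by_cases hzO : z ∈ O
    · rw [hl0 (Or.inl ⟨hz, hzO⟩)]; simp
    · rw [hl1 (Or.inl ⟨hz, hzO⟩)]; simp [hexpc]
  have hφ0 : ∀ z, φ z ≠ 0 := by
    intro z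
    simp only [hφ]
    split_ifs
    · exact Complex.exp_ne_zero _
    · exact one_ne_zero
  have hsc : IsSimplyConnected (univ : Set ℂ) := by
    have : ContractibleSpace (univ : Set ℂ) := convex_univ.contractibleSpace univ_nonempty
    exact (inferInstance : SimplyConnectedSpace (univ : Set ℂ))
  obtain ⟨θ, hθc, hθ⟩ := Complex.exists_continuousOn_eqOn_exp_comp hsc isOpen_univ hφc.continuousOn
    (by simpa using hφ0)
  rw [continuousOn_univ] at hθc
  have hθ' : ∀ z, Complex.exp (θ z) = φ z := fun z => hθ (mem_univ z)
  have h1 : ∀ z ∈ closedBall (0 : ℂ) R, φ z = 1 := by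
    intro z hz
    simp only [hφ, hl0 (Or.inr hz)]
    simp
  have h2 : ∀ z, ρ < ‖z‖ → φ z = 1 := by
    intro z hz
    simp only [hφ, hl1 (Or.inr hz.le)]
    simp [hexpc]
  have hsR : s ∈ closedBall (0 : ℂ) R := by simp [R]
  have htR : t ∈ closedBall (0 : ℂ) R := by simp [R]
  have hst : θ s = θ t := (convex_closedBall (0 : ℂ) R).isPreconnected.eq_of_exp_eq_one
    hθc.continuousOn (fun z hz => by rw [hθ', h1 z hz]) hsR htR
  have far : ∀ B : Set ℂ, ¬ Bornology.IsBounded B → ∃ z ∈ B, ρ < ‖z‖ := by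
    intro B hB
    by_contra! h
    exact hB (isBounded_closedBall.subset fun z hz => mem_closedBall_zero_iff.2 (h z hz))
  obtain ⟨s', hs', hs'ρ⟩ := far S hSb
  obtain ⟨t', ht', ht'ρ⟩ := far T hTb
  have hst' : θ s' = θ t' := (isPreconnected_setOf_lt_norm ρ).eq_of_exp_eq_one
    hθc.continuousOn (fun z hz => by rw [hθ', h2 z hz]) hs'ρ ht'ρ
  have htt : θ t = θ t' := hT.eq_of_exp_eq_one hθc.continuousOn
    (fun z hz => by rw [hθ']; simp [hφ, Set.disjoint_left.1 hTA hz]) ht ht'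
  have hss : θ s - l s * c = θ s' - l s' * c := hS.eq_of_exp_eq_one (h := fun z => θ z - l z * c)
    (by fun_prop)
    (fun z hz => by
      rw [Complex.exp_sub, hθ']
      simp [hφ, hSA hz]) hs hs'
  rw [hl0 (Or.inr hsR), hl1 (Or.inr hs'ρ.le), hst, hst', htt] at hss
  have : c = 0 := by simpa [sub_eq_self] using hss.symm
  exact Complex.two_pi_I_ne_zero this

/-! ### Preimages under a function with a Baker omitted value -/

lemma mem_connectedComponentIn_of_mem_closure {X : Type*} [TopologicalSpace X] {A : Set X} {x y : X}
    (hy : y ∈ closure (connectedComponentIn A x)) (hyA : y ∈ A) : y ∈ connectedComponentIn A x := by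
  by_cases hx : x ∈ A
  · have h : IsPreconnected (insert y (connectedComponentIn A x)) :=
      isPreconnected_connectedComponentIn.subset_closure (subset_insert _ _)
        (insert_subset hy subset_closure)
    exact h.subset_connectedComponentIn (mem_insert_of_mem _ (mem_connectedComponentIn hx))
      (insert_subset hyA (connectedComponentIn_subset _ _)) (mem_insert _ _)
  · simp [connectedComponentIn_eq_empty hx] at hy

/-- By the maximum principle, the components of a superlevel set of an entire function are
unbounded. -/
lemma not_isBounded_component_superlevel {g : ℂ → ℂ} (hg : Differentiable ℂ g) {ρ : ℝ} {a : ℂ}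
    (ha : ρ < ‖g a‖) :
    ¬ Bornology.IsBounded (connectedComponentIn {z | ρ < ‖g z‖} a) := by
  intro hb
  set A : Set ℂ := {z | ρ < ‖g z‖}
  have hA : IsOpen A := isOpen_lt continuous_const hg.continuous.norm
  have haC : a ∈ connectedComponentIn A a := mem_connectedComponentIn (F := A) ha
  have := Complex.norm_le_of_forall_mem_frontier_norm_le hb hg.diffContOnCl (C := ρ) (fun z hz => by
    rw [hA.connectedComponentIn.frontier_eq] at hz
    by_contra h
    exact hz.2 (mem_connectedComponentIn_of_mem_closure hz.1 (not_le.1 h))) (subset_closure haC)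
  exact absurd ha (not_lt.2 this)

lemma isBounded_component_sublevel {g : ℂ → ℂ} (hg : Differentiable ℂ g)
    (hnc : ¬ ∃ c, ∀ z, g z = c) {ρ : ℝ}
    (hρ : ∀ x ∈ frontier {z | ρ < ‖g z‖},
      Bornology.IsBounded (connectedComponentIn (frontier {z | ρ < ‖g z‖}) x)) (ζ : ℂ) :
    Bornology.IsBounded (connectedComponentIn {z | ‖g z‖ ≤ ρ} ζ) := by
  by_contra hb
  have hζ : ζ ∈ {z | ‖g z‖ ≤ ρ} := by
    by_contra h
    rw [connectedComponentIn_eq_empty h] at hb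
    exact hb Bornology.isBounded_empty
  obtain ⟨a, ha⟩ : ∃ a, ρ < ‖g a‖ := by
    by_contra! h
    refine hnc (hg.exists_const_forall_eq_of_bounded ?_)
    exact isBounded_closedBall.subset (range_subset_iff.2 fun z => mem_closedBall_zero_iff.2 (h z))
  refine false_of_unbounded_of_frontier_components_bounded hρ
    (isPreconnected_connectedComponentIn (x := a)) isPreconnected_connectedComponentIn
    (connectedComponentIn_subset _ _) ?_ ⟨a, mem_connectedComponentIn (F := {z | ρ < ‖g z‖}) ha⟩
    ⟨ζ, mem_connectedComponentIn hζ⟩ (not_isBounded_component_superlevel hg ha) hb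
  rw [Set.disjoint_left]
  intro z hz hz'
  have h : ‖g z‖ ≤ ρ := connectedComponentIn_subset {z | ‖g z‖ ≤ ρ} _ hz
  exact absurd hz' (not_lt.2 h)

lemma finite_fiber_inter_compact {g : ℂ → ℂ} (hg : Differentiable ℂ g)
    (hnc : ¬ ∃ c, ∀ z, g z = c) {K : Set ℂ} (hK : IsCompact K) (w : ℂ) :
    (K ∩ g ⁻¹' {w}).Finite := by
  by_contra hinf
  obtain ⟨x, -, hx⟩ := Set.Infinite.exists_accPt_of_subset_isCompact hinf hK inter_subset_left
  have hfr : ∃ᶠ z in 𝓝[≠] x, g z = w := by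
    rw [accPt_iff_frequently_nhdsNE] at hx
    exact hx.mono fun z hz => hz.2
  have hga : AnalyticOnNhd ℂ g univ := hg.differentiableOn.analyticOnNhd isOpen_univ
  have := hga.eqOn_of_preconnected_of_frequently_eq (analyticOnNhd_const (v := w))
    isPreconnected_univ (mem_univ x) hfr
  exact hnc ⟨w, fun z => this (mem_univ z)⟩

/-- An entire function maps a bounded component of the preimage of a domain `W` onto `W`, since it
is a proper map from this component to `W`. -/
lemma subset_image_component_of_isBounded {g : ℂ → ℂ} (hg : Differentiable ℂ g)
    (hnc : ¬ ∃ c, ∀ z, g z = c) {W : Set ℂ} (hW : IsOpen W) (hWc : IsPreconnected W) {x : ℂ}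
    (hx : g x ∈ W) (hb : Bornology.IsBounded (connectedComponentIn (g ⁻¹' W) x)) :
    W ⊆ g '' connectedComponentIn (g ⁻¹' W) x := by
  have hga : AnalyticOnNhd ℂ g univ := hg.differentiableOn.analyticOnNhd isOpen_univ
  have hopen : IsOpenMap g := hga.is_constant_or_isOpenMap.resolve_left hnc
  have hxV : x ∈ connectedComponentIn (g ⁻¹' W) x := mem_connectedComponentIn (F := g ⁻¹' W) hx
  refine hWc.subset_of_closure_inter_subset
    (hopen _ (hW.preimage hg.continuous).connectedComponentIn) ⟨g x, hx, x, hxV, rfl⟩ ?_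
  rintro w ⟨hw, hwW⟩
  have hcl : closure (g '' connectedComponentIn (g ⁻¹' W) x) ⊆
      g '' closure (connectedComponentIn (g ⁻¹' W) x) :=
    closure_minimal (image_mono subset_closure)
      (hb.isCompact_closure.image hg.continuous).isClosed
  obtain ⟨v, hv, rfl⟩ := hcl hw
  exact ⟨v, mem_connectedComponentIn_of_mem_closure hv hwW, rfl⟩

/-- If `W` lies in the disc of radius `ρ` and the frontier of `{|g| > ρ}` has only bounded
components, then finitely many components of `g⁻¹(W)` cover `g⁻¹(W)` near `ζ`. The finite set `Z` is
a fibre of `g` in the component of `{|g| ≤ ρ}` which contains `ζ`. -/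
lemma exists_finite_meeting_components_preimage {g : ℂ → ℂ} (hg : Differentiable ℂ g)
    (hnc : ¬ ∃ c, ∀ z, g z = c) {ρ : ℝ}
    (hρ : ∀ x ∈ frontier {z | ρ < ‖g z‖},
      Bornology.IsBounded (connectedComponentIn (frontier {z | ρ < ‖g z‖}) x))
    {W : Set ℂ} (hW : IsOpen W) (hWc : IsPreconnected W) (hWρ : W ⊆ ball 0 ρ)
    {ζ : ℂ} (hζ : ‖g ζ‖ < ρ) :
    ∃ Z : Set ℂ, Z.Finite ∧ ∀ᶠ x in 𝓝 ζ, g x ∈ W →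
      ∃ z ∈ Z, z ∈ connectedComponentIn (g ⁻¹' W) x := by
  rcases W.eq_empty_or_nonempty with rfl | ⟨w, hw⟩
  · exact ⟨∅, finite_empty, by simp⟩
  set L : Set ℂ := {z | ‖g z‖ ≤ ρ}
  have hKb := isBounded_component_sublevel hg hnc hρ ζ
  refine ⟨_, finite_fiber_inter_compact hg hnc hKb.isCompact_closure w, ?_⟩
  obtain ⟨ε, hε, hεL⟩ := Metric.isOpen_iff.1 (isOpen_lt hg.continuous.norm continuous_const) ζ hζ
  filter_upwards [ball_mem_nhds ζ hε] with x hx hxW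
  have hxK : x ∈ connectedComponentIn L ζ :=
    (convex_ball ζ ε).isPreconnected.subset_connectedComponentIn (mem_ball_self hε)
      (fun z hz => show ‖g z‖ ≤ ρ from le_of_lt (hεL hz)) hx
  have hVK : connectedComponentIn (g ⁻¹' W) x ⊆ connectedComponentIn L ζ := by
    rw [connectedComponentIn_eq hxK]
    refine isPreconnected_connectedComponentIn.subset_connectedComponentIn
      (mem_connectedComponentIn (F := g ⁻¹' W) hxW) fun z hz => ?_
    exact (mem_ball_zero_iff.1 (hWρ (connectedComponentIn_subset (g ⁻¹' W) _ hz))).le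
  obtain ⟨z, hz, hzw⟩ := subset_image_component_of_isBounded hg hnc hW hWc hxW
    (hKb.subset hVK) hw
  exact ⟨z, ⟨subset_closure (hVK hz), hzw⟩, hz⟩

lemma IsMeromorphicOnPlane.analyticAt {f : ℂ → ℂ} (hf : IsMeromorphicOnPlane f) {z : ℂ}
    (hz : ¬ IsPole f z) : AnalyticAt ℂ f z :=
  (hf (mem_univ z)).meromorphicOrderAt_nonneg_iff_analyticAt.1 (not_lt.1 hz)

/-- The reciprocal `g = 1 / (f - b)` of a meromorphic function with an omitted value `b` is entire,
with zeros exactly at the poles of `f`. -/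
lemma exists_entire_reciprocal {f : ℂ → ℂ} (hf : IsMeromorphicOnPlane f) {b : ℂ}
    (hb : IsOmittedValue f b) :
    ∃ g : ℂ → ℂ, Differentiable ℂ g ∧ (∀ z, g z = 0 ↔ IsPole f z) ∧
      ∀ z, ¬ IsPole f z → f z = b + (g z)⁻¹ := by
  classical
  set g : ℂ → ℂ := fun z => if IsPole f z then 0 else (f z - b)⁻¹ with hg
  have hgn : ∀ z, ¬ IsPole f z → g z = (f z - b)⁻¹ := fun z hz => by simp [hg, hz]
  have hgp : ∀ z, IsPole f z → g z = 0 := fun z hz => by simp [hg, hz]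
  have hne : ∀ z, ¬ IsPole f z → f z - b ≠ 0 := fun z hz => sub_ne_zero.2 (hb z hz)
  -- the poles are isolated
  have hev : ∀ z, ∀ᶠ w in 𝓝[≠] z, AnalyticAt ℂ f w := fun z =>
    (hf (mem_univ z)).meromorphicAt.eventually_analyticAt
  have han : ∀ w, AnalyticAt ℂ f w → ¬ IsPole f w := fun w hw =>
    not_lt.2 hw.meromorphicOrderAt_nonneg
  have hdiff : ∀ z, ¬ IsPole f z → DifferentiableAt ℂ g z := by
    intro z hz
    have h1 := hf.analyticAt hz
    have h2 : g =ᶠ[𝓝 z] fun w => (f w - b)⁻¹ := by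
      filter_upwards [h1.eventually_analyticAt] with w hw using hgn w (han w hw)
    refine DifferentiableAt.congr_of_eventuallyEq ?_ h2
    exact (h1.differentiableAt.sub_const b).inv (hne z hz)
  refine ⟨g, fun z => ?_, fun z => ?_, fun z hz => ?_⟩
  · by_cases hz : IsPole f z
    · refine AnalyticAt.differentiableAt
        (Complex.analyticAt_of_differentiable_on_punctured_nhds_of_continuousAt ?_ ?_)
      · filter_upwards [hev z] with w hw using hdiff w (han w hw)
      · rw [continuousAt_iff_punctured_nhds, hgp z hz]
        have h1 : Tendsto (fun w => f w - b) (𝓝[≠] z) (Bornology.cobounded ℂ) := by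
          exact (tendsto_sub_const_cobounded b).comp
            (tendsto_cobounded_of_meromorphicOrderAt_neg hz)
        refine (Filter.tendsto_inv₀_cobounded.comp h1).congr' ?_
        filter_upwards [hev z] with w hw using (hgn w (han w hw)).symm
    · exact hdiff z hz
  · constructor
    · intro h
      by_contra hz
      rw [hgn z hz] at h
      exact hne z hz (inv_eq_zero.1 h)
    · exact hgp z
  · rw [hgn z hz]; simp

lemma iterPreimage_one {f : ℂ → ℂ} (A : Set ℂ) :
    iterPreimage f 1 A = {z | ¬ IsPole f z ∧ f z ∈ A} := by
  ext z; simp [iterPreimage]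

lemma iterPreimage_one_ball {f g : ℂ → ℂ} {b : ℂ} (hg0 : ∀ z, g z = 0 ↔ IsPole f z)
    (hfg : ∀ z, ¬ IsPole f z → f z = b + (g z)⁻¹) {r : ℝ} (hr : 0 < r) :
    iterPreimage f 1 (ball b r) = {z | r⁻¹ < ‖g z‖} := by
  ext z
  rw [iterPreimage_one, mem_ofPred_eq, mem_ofPred_eq]
  by_cases hz : IsPole f z
  · simp [hz, (hg0 z).2 hz, hr.le]
  · have : 0 < ‖g z‖ := norm_pos_iff.2 fun h => hz ((hg0 z).1 h)
    simp only [hz, not_false_eq_true, true_and, hfg z hz, mem_ball, dist_eq_norm,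
      add_sub_cancel_left, norm_inv]
    exact inv_lt_comm₀ this hr

/-- Near a point `ζ` which is not a pole, the preimage of a domain `U` is covered by finitely many
of its components, provided that the Baker omitted value `b` is not on the frontier of `U`. -/
theorem exists_finite_meeting_components {f : ℂ → ℂ} (hf : IsMeromorphicOnPlane f)
    {b : ℂ} (hb : IsBakerOmittedValue f b) (hbp : ¬ IsPole f b) (hp : ∃ a, IsPole f a)
    {U : Set ℂ} (hU : IsOpen U) (hUc : IsPreconnected U) (hbU : b ∉ frontier U)
    {ζ : ℂ} (hζ : ¬ IsPole f ζ) :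
    ∃ Z : Set ℂ, Z.Finite ∧ ∀ᶠ x in 𝓝 ζ, f x ∈ U →
      ∃ z ∈ Z, x ∈ connectedComponentIn (iterPreimage f 1 U) z := by
  obtain ⟨hom, r₀, hr₀, hbd⟩ := hb
  obtain ⟨g, hg, hg0, hfg⟩ := exists_entire_reciprocal hf hom
  have hnc : ¬ ∃ c, ∀ z, g z = c := by
    rintro ⟨c, hc⟩
    obtain ⟨a, ha⟩ := hp
    exact hbp ((hg0 b).1 (by rw [hc b, ← hc a, (hg0 a).2 ha]))
  have hζg : g ζ ≠ 0 := fun h => hζ ((hg0 ζ).1 h)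
  -- a radius for which the closed disc about `b` lies either inside or outside `U`
  obtain ⟨r, hr, hrr₀, hrζ, hrU⟩ : ∃ r : ℝ, 0 < r ∧ r < r₀ ∧ r < ‖g ζ‖⁻¹ ∧
      (closedBall b r ⊆ U ∨ Disjoint (closedBall b r) U) := by
    have h1 : ∀ᶠ r : ℝ in 𝓝[>] 0, closedBall b r ⊆ U ∨ Disjoint (closedBall b r) U := by
      by_cases hbU' : b ∈ U
      · filter_upwards [nhdsWithin_le_nhds (eventually_closedBall_subset (hU.mem_nhds hbU'))]
          with r hr using Or.inl hr
      · have : b ∈ (closure U)ᶜ := fun h => hbU (by rw [hU.frontier_eq]; exact ⟨h, hbU'⟩)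
        filter_upwards [nhdsWithin_le_nhds (eventually_closedBall_subset
          (isClosed_closure.isOpen_compl.mem_nhds this))] with r hr
        exact Or.inr (disjoint_left.2 fun z hz hzU => hr hz (subset_closure hzU))
    have h2 : ∀ᶠ r : ℝ in 𝓝[>] 0, r < min r₀ ‖g ζ‖⁻¹ :=
      nhdsWithin_le_nhds (eventually_lt_nhds (lt_min hr₀ (inv_pos.2 (norm_pos_iff.2 hζg))))
    obtain ⟨r, ⟨h1, h2⟩, h3⟩ := ((h1.and h2).and self_mem_nhdsWithin).exists
    exact ⟨r, h3, (lt_min_iff.1 h2).1, (lt_min_iff.1 h2).2, h1⟩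
  have hU'c : IsPreconnected (U \ closedBall b r) := by
    rcases hrU with h | h
    · exact isPreconnected_diff_closedBall hU hUc hr h
    · rwa [h.symm.sdiff_eq_left]
  set W : Set ℂ := (fun u => (u - b)⁻¹) '' (U \ closedBall b r) with hWdef
  have hWc : IsPreconnected W := by
    refine hU'c.image _ (ContinuousOn.inv₀ (by fun_prop) fun u hu => ?_)
    rintro h
    exact hu.2 (by rw [sub_eq_zero.1 h]; exact mem_closedBall_self hr.le)
  have hWeq : W = {w | w ≠ 0} ∩ (fun w => b + w⁻¹) ⁻¹' (U \ closedBall b r) := by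
    ext w
    constructor
    · rintro ⟨u, hu, rfl⟩
      refine ⟨inv_ne_zero fun h => hu.2 ?_, by simpa using hu⟩
      rw [sub_eq_zero.1 h]; exact mem_closedBall_self hr.le
    · rintro ⟨h1, h2⟩
      exact ⟨_, h2, by simp⟩
  have hW : IsOpen W := by
    rw [hWeq]
    refine ContinuousOn.isOpen_inter_preimage ?_ isOpen_ne (hU.sdiff isClosed_closedBall)
    exact continuousOn_const.add (continuousOn_id.inv₀ fun w hw => hw)
  have hWρ : W ⊆ ball 0 r⁻¹ := by
    rintro _ ⟨u, hu, rfl⟩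
    have h := hu.2
    rw [mem_closedBall, dist_eq_norm, not_le] at h
    rw [mem_ball_zero_iff, norm_inv]
    exact inv_strictAnti₀ hr h
  have hρ : ∀ x ∈ frontier {z | r⁻¹ < ‖g z‖},
      Bornology.IsBounded (connectedComponentIn (frontier {z | r⁻¹ < ‖g z‖}) x) := by
    rw [← iterPreimage_one_ball hg0 hfg hr]
    exact fun x hx => hbd r hr hrr₀ _ ⟨x, hx, rfl⟩
  have hgζ : ‖g ζ‖ < r⁻¹ := (lt_inv_comm₀ hr (norm_pos_iff.2 hζg)).1 hrζ
  obtain ⟨Z, hZ, hev⟩ := exists_finite_meeting_components_preimage hg hnc hρ hW hWc hWρ hgζ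
  refine ⟨Z, hZ, ?_⟩
  filter_upwards [hev, hg.continuous.continuousAt.eventually_ne hζg,
    hg.continuous.norm.continuousAt.eventually_lt continuousAt_const hgζ] with x hx hx0 hxr hxU
  have hxp : ¬ IsPole f x := fun h => hx0 ((hg0 x).2 h)
  have hxW : g x ∈ W := by
    rw [hWeq]
    refine ⟨hx0, ?_⟩
    rw [hfg x hxp] at hxU
    refine ⟨hxU, ?_⟩
    rw [mem_closedBall, dist_eq_norm, add_sub_cancel_left, norm_inv, not_le]
    exact (lt_inv_comm₀ (norm_pos_iff.2 hx0) hr).1 hxr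
  obtain ⟨z, hzZ, hz⟩ := hx hxW
  refine ⟨z, hzZ, ?_⟩
  have hsub : connectedComponentIn (g ⁻¹' W) x ⊆ iterPreimage f 1 U := by
    intro y hy
    have := connectedComponentIn_subset _ _ hy
    rw [mem_preimage, hWeq] at this
    have hyp : ¬ IsPole f y := fun h => this.1 ((hg0 y).2 h)
    rw [iterPreimage_one]
    refine ⟨hyp, ?_⟩
    rw [hfg y hyp]
    exact this.2.1
  exact isPreconnected_connectedComponentIn.subset_connectedComponentIn hz hsub
    (mem_connectedComponentIn (F := g ⁻¹' W) hxW)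

/-! ### The theorems of Bloch, Schottky and Montel -/

/-- Bloch's theorem, without a good constant. At a point `a` where the product of `|g'|` and the
distance to the boundary of the half-size disc is largest, `g'` varies little on a disc of
comparable radius, and there `g` is a small perturbation of an affine map. -/
lemma exists_ball_subset_image {g : ℂ → ℂ} {c : ℂ} {R : ℝ} (hR : 0 < R)
    (hg : DifferentiableOn ℂ g (ball c R)) :
    ∃ w, ball w (R * ‖deriv g c‖ / 128) ⊆ g '' ball c R := by
  by_cases hc0 : deriv g c = 0
  · exact ⟨0, by simp [hc0]⟩
  have hdc : 0 < ‖deriv g c‖ := norm_pos_iff.2 hc0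
  have hg' : DifferentiableOn ℂ (deriv g) (ball c R) := hg.deriv isOpen_ball
  have hsub : closedBall c (R / 2) ⊆ ball c R := closedBall_subset_ball (by linarith)
  obtain ⟨a, ha, hmax⟩ := (isCompact_closedBall c (R / 2)).exists_isMaxOn
    ⟨c, mem_closedBall_self (by linarith)⟩
    (f := fun z => (R / 2 - ‖z - c‖) * ‖deriv g z‖)
    (ContinuousOn.mul (by fun_prop) (hg'.continuousOn.mono hsub).norm)
  have hmax' : ∀ z ∈ closedBall c (R / 2),
      (R / 2 - ‖z - c‖) * ‖deriv g z‖ ≤ (R / 2 - ‖a - c‖) * ‖deriv g a‖ := fun z hz => hmax hz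
  have h0 := hmax' c (mem_closedBall_self (by linarith))
  rw [sub_self, norm_zero, sub_zero] at h0
  have hac : ‖a - c‖ ≤ R / 2 := by rwa [mem_closedBall, dist_eq_norm] at ha
  set A : ℝ := ‖deriv g a‖ with hA
  set s : ℝ := (R / 2 - ‖a - c‖) / 2 with hs
  have hM : 0 < 2 * s * A := by
    have : 2 * s = R / 2 - ‖a - c‖ := by rw [hs]; ring
    rw [this]; exact lt_of_lt_of_le (by positivity) h0
  have hs0 : 0 < s := by
    rcases (show 0 ≤ s by rw [hs]; linarith).eq_or_lt with h | h
    · rw [← h] at hM; simp at hM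
    · exact h
  have hA0 : 0 < A := by
    rcases (norm_nonneg (deriv g a)).eq_or_lt with h | h
    · rw [hA, ← h] at hM; simp at hM
    · exact h
  have hball : ∀ z ∈ ball a s, z ∈ closedBall c (R / 2) ∧ s ≤ R / 2 - ‖z - c‖ := by
    intro z hz
    rw [mem_ball, dist_eq_norm] at hz
    have h1 : ‖z - c‖ ≤ ‖z - a‖ + ‖a - c‖ := norm_sub_le_norm_sub_add_norm_sub z a c
    rw [mem_closedBall, dist_eq_norm]
    constructor <;> linarith
  have hderiv : ∀ z ∈ ball a s, ‖deriv g z‖ ≤ 2 * A := by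
    intro z hz
    obtain ⟨h1, h2⟩ := hball z hz
    have h3 := hmax' z h1
    have h4 : s * ‖deriv g z‖ ≤ 2 * s * A := by
      calc s * ‖deriv g z‖ ≤ (R / 2 - ‖z - c‖) * ‖deriv g z‖ := by gcongr
        _ ≤ _ := h3
        _ = 2 * s * A := by rw [hs]; ring
    nlinarith
  have hclose : ∀ z ∈ ball a s, ‖deriv g z - deriv g a‖ ≤ 4 * A / s * ‖z - a‖ := by
    intro z hz
    have hd : DifferentiableOn ℂ (deriv g) (ball a s) := hg'.mono fun z hz => hsub (hball z hz).1
    have := Complex.dist_le_div_mul_dist_of_mapsTo_ball hd (R₂ := 4 * A) (fun w hw => by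
      have h1 := hderiv w hw
      have h2 := norm_sub_le (deriv g w) (deriv g a)
      rw [mem_closedBall, dist_eq_norm]
      linarith) hz
    rwa [dist_eq_norm, dist_eq_norm] at this
  have hs8 : closedBall a (s / 8) ⊆ ball a s := closedBall_subset_ball (by linarith)
  have hgd : ∀ z ∈ ball a s, DifferentiableAt ℂ g z := fun z hz =>
    hg.differentiableAt (isOpen_ball.mem_nhds (hsub (hball z hz).1))
  -- on a small disc about `a`, `g` is close to its linearization
  have hlin : ∀ z ∈ closedBall a (s / 8), ‖g z - g a - deriv g a * (z - a)‖ ≤ A / 2 * ‖z - a‖ := by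
    intro z hz
    have hder : ∀ w ∈ closedBall a (s / 8), HasDerivWithinAt (fun w => g w - deriv g a * w)
        (deriv g w - deriv g a) (closedBall a (s / 8)) w := by
      intro w hw
      have h1 := (hgd w (hs8 hw)).hasDerivAt.fun_sub ((hasDerivAt_id' w).const_mul (deriv g a))
      rw [mul_one] at h1
      exact h1.hasDerivWithinAt
    have := (convex_closedBall a (s / 8)).norm_image_sub_le_of_norm_hasDerivWithin_le hder
      (C := A / 2) (fun w hw => by
        refine (hclose w (hs8 hw)).trans ?_
        rw [mem_closedBall, dist_eq_norm] at hw
        calc 4 * A / s * ‖w - a‖ ≤ 4 * A / s * (s / 8) := by gcongr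
          _ = A / 2 := by field_simp; norm_num) (mem_closedBall_self (by positivity)) hz
    have heq : g z - g a - deriv g a * (z - a) =
        (g z - deriv g a * z) - (g a - deriv g a * a) := by ring
    rw [heq]
    exact this
  have hsphere : ∀ z ∈ sphere a (s / 8), A * s / 16 ≤ ‖g z - g a‖ := by
    intro z hz
    have h1 := hlin z (sphere_subset_closedBall hz)
    rw [mem_sphere, dist_eq_norm] at hz
    have h2 : ‖deriv g a * (z - a)‖ = A * (s / 8) := by rw [norm_mul, hz]
    have h3 := norm_sub_norm_le (deriv g a * (z - a)) (deriv g a * (z - a) - (g z - g a))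
    rw [sub_sub_cancel, norm_sub_rev (deriv g a * (z - a)), h2] at h3
    rw [hz] at h1
    linarith
  have hfreq : ∃ᶠ z in 𝓝 a, g z ≠ g a := by
    intro h
    have h1 : g =ᶠ[𝓝 a] fun _ => g a := by
      filter_upwards [h] with z hz using not_not.1 hz
    have h2 := h1.deriv_eq
    rw [deriv_const] at h2
    rw [hA, h2, norm_zero] at hA0
    exact lt_irrefl _ hA0
  have hdc : DiffContOnCl ℂ g (ball a (s / 8)) := by
    refine DifferentiableOn.diffContOnCl fun z hz => ?_
    exact (hgd z (hs8 (closure_ball_subset_closedBall hz))).differentiableWithinAt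
  have himage := hdc.ball_subset_image_closedBall (by positivity) hsphere hfreq
  refine ⟨g a, (ball_subset_ball ?_).trans (himage.trans (image_mono ?_))⟩
  · have : 2 * s * A = (R / 2 - ‖a - c‖) * A := by rw [hs]; ring
    rw [← this] at h0
    linarith
  · exact hs8.trans fun z hz => hsub (hball z hz).1

lemma exists_log_on_ball {F : ℂ → ℂ} {c : ℂ} {R : ℝ} (hR : 0 < R)
    (hF : DifferentiableOn ℂ F (ball c R)) (h0 : ∀ z ∈ ball c R, F z ≠ 0) {a : ℂ}
    (ha : Complex.exp a = F c) :
    ∃ u : ℂ → ℂ, DifferentiableOn ℂ u (ball c R) ∧ u c = a ∧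
      ∀ z ∈ ball c R, Complex.exp (u z) = F z := by
  have hq : DifferentiableOn ℂ (fun z => deriv F z / F z) (ball c R) :=
    (hF.deriv isOpen_ball).div hF h0
  obtain ⟨u, hua, hu⟩ := hq.isExactOn_ball.with_val_at c a
  have hc : c ∈ ball c R := mem_ball_self hR
  have hder : ∀ z ∈ ball c R, HasDerivAt (fun z => F z * Complex.exp (-u z)) 0 z := by
    intro z hz
    have h1 := (hF.differentiableAt (isOpen_ball.mem_nhds hz)).hasDerivAt.fun_mul
      ((hu z hz).fun_neg.cexp)
    have h2 : deriv F z * Complex.exp (-u z) +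
        F z * (Complex.exp (-u z) * -(deriv F z / F z)) = 0 := by
      have := h0 z hz
      field_simp
      ring
    rwa [h2] at h1
  refine ⟨u, fun z hz => (hu z hz).differentiableAt.differentiableWithinAt, hua, fun z hz => ?_⟩
  have hconst := (convex_ball c R).is_const_of_fderivWithin_eq_zero (𝕜 := ℂ)
    (f := fun z => F z * Complex.exp (-u z))
    (fun w hw => (hder w hw).differentiableAt.differentiableWithinAt)
    (fun w hw => by
      have := (hder w hw).hasFDerivAt.hasFDerivWithinAt (s := ball c R)
      rw [this.fderivWithin (isOpen_ball.uniqueDiffWithinAt hw)]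
      ext; simp) hz hc
  simp only [hua, ← ha, ← Complex.exp_add, add_neg_cancel, Complex.exp_zero] at hconst
  rw [Complex.exp_neg, ← div_eq_mul_inv, div_eq_one_iff_eq (Complex.exp_ne_zero _)] at hconst
  exact hconst.symm

/-- Every disc of radius `3` contains one of the points `± arsinh √n + iπm`, where `cosh ^ 2` takes
the value `n + 1`. -/
lemma exists_cosh_sq_eq_nat (w : ℂ) :
    ∃ (a : ℂ) (n : ℕ), a ∈ ball w 3 ∧ Complex.cosh a ^ 2 = n := by
  set m : ℤ := round (w.im / Real.pi) with hm
  set n : ℕ := ⌊Real.sinh |w.re| ^ 2⌋₊ with hn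
  set t : ℝ := Real.arsinh √n with ht
  have hpi := Real.pi_pos
  have hsinh : Real.sinh t ^ 2 = n := by
    rw [ht, Real.sinh_arsinh, Real.sq_sqrt (Nat.cast_nonneg n)]
  have ht0 : 0 ≤ t := Real.arsinh_nonneg_iff.2 (Real.sqrt_nonneg _)
  have hle : t ≤ |w.re| := by
    have h1 : (n : ℝ) ≤ Real.sinh |w.re| ^ 2 := Nat.floor_le (sq_nonneg _)
    rw [← hsinh] at h1
    exact Real.sinh_le_sinh.1 (le_of_sq_le_sq h1 (Real.sinh_nonneg_iff.2 (abs_nonneg _)))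
  have hge : |w.re| ≤ t + 1 := by
    have h1 : Real.sinh |w.re| ^ 2 < n + 1 := Nat.lt_floor_add_one _
    have h2 : Real.sinh t + 1 ≤ Real.sinh (t + 1) := by
      rw [Real.sinh_add]
      have h3 := Real.one_le_cosh 1
      have h4 := Real.one_le_cosh t
      have h5 : (1 : ℝ) ≤ Real.sinh 1 := Real.self_le_sinh_iff.2 zero_le_one
      have h6 : 0 ≤ Real.sinh t := Real.sinh_nonneg_iff.2 ht0
      nlinarith
    have h6 : 0 ≤ Real.sinh t := Real.sinh_nonneg_iff.2 ht0
    refine Real.sinh_le_sinh.1 (le_of_sq_le_sq ?_ (by linarith))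
    rw [← hsinh] at h1
    nlinarith
  -- the lattice point nearest to `w`
  obtain ⟨x, hx, hxw⟩ : ∃ x : ℝ, Real.sinh x ^ 2 = n ∧ |x - w.re| ≤ 1 := by
    rcases abs_cases w.re with ⟨h, -⟩ | ⟨h, -⟩
    · exact ⟨t, hsinh, by rw [abs_le]; constructor <;> linarith⟩
    · exact ⟨-t, by rw [Real.sinh_neg, neg_sq, hsinh], by rw [abs_le]; constructor <;> linarith⟩
  refine ⟨x + m * (Real.pi * Complex.I), n + 1, ?_, ?_⟩
  · rw [mem_ball, dist_eq_norm]
    have him : |m * Real.pi - w.im| ≤ Real.pi / 2 := by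
      have h1 := abs_sub_round (w.im / Real.pi)
      rw [← hm, abs_sub_comm] at h1
      calc |m * Real.pi - w.im| = |m - w.im / Real.pi| * Real.pi := by
            rw [← abs_of_pos hpi, ← abs_mul, abs_of_pos hpi]; congr 1; field_simp
        _ ≤ 1 / 2 * Real.pi := by gcongr
        _ = _ := by ring
    refine (Complex.norm_le_abs_re_add_abs_im _).trans_lt ?_
    simp only [Complex.sub_re, Complex.sub_im, Complex.add_re, Complex.add_im, Complex.ofReal_re,
      Complex.ofReal_im, Complex.mul_re, Complex.mul_im, Complex.intCast_re, Complex.intCast_im,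
      Complex.I_re, Complex.I_im]
    have := Real.pi_lt_d2
    simp only [mul_zero, zero_mul, sub_zero, add_zero, zero_add, mul_one]
    linarith
  · have h1 : Complex.cosh (x + m * (Real.pi * Complex.I)) ^ 2 = Complex.cosh x ^ 2 := by
      rw [Complex.cosh_add, ← mul_assoc, Complex.cosh_mul_I, Complex.sinh_mul_I]
      have hs : Complex.sin (m * Real.pi) = 0 := Complex.sin_int_mul_pi m
      have hc : Complex.cos (m * Real.pi) ^ 2 = 1 := by
        have := Complex.sin_sq_add_cos_sq (m * Real.pi)
        rw [hs] at this; simpa using this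
      rw [hs, zero_mul, mul_zero, add_zero, mul_pow, hc, mul_one]
    rw [h1, Complex.cosh_sq, ← Complex.ofReal_sinh]
    have : ((Real.sinh x ^ 2 : ℝ) : ℂ) = n := by rw [hx]; simp
    push_cast at this ⊢
    rw [this]

/-- If `cosh² v` omits the natural numbers, then the image of `v` contains no disc of radius `3`,
and Bloch's theorem bounds the derivative of `v`. -/
lemma norm_sub_le_of_omits_lattice {v : ℂ → ℂ} {c : ℂ} {R : ℝ} (hR : 0 < R)
    (hv : DifferentiableOn ℂ v (ball c R))
    (hom : ∀ z ∈ ball c R, ∀ n : ℕ, Complex.cosh (v z) ^ 2 ≠ n) {z : ℂ} (hz : z ∈ ball c (R / 2)) :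
    ‖v z - v c‖ ≤ 384 := by
  have hderiv : ∀ w ∈ ball c (R / 2), ‖deriv v w‖ ≤ 768 / R := by
    intro w hw
    have hsub : ball w (R / 2) ⊆ ball c R := by
      refine ball_subset_ball' ?_
      rw [mem_ball] at hw; linarith
    obtain ⟨y, hy⟩ := exists_ball_subset_image (half_pos hR) (hv.mono hsub)
    obtain ⟨a, n, ha, han⟩ := exists_cosh_sq_eq_nat y
    by_contra hlt
    rw [not_le, div_lt_iff₀ hR] at hlt
    have : a ∈ ball y (R / 2 * ‖deriv v w‖ / 128) := ball_subset_ball (by linarith) ha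
    obtain ⟨x, hx, rfl⟩ := hy this
    exact hom x (hsub hx) n han
  have hc : c ∈ ball c (R / 2) := mem_ball_self (half_pos hR)
  have := (convex_ball c (R / 2)).norm_image_sub_le_of_norm_deriv_le (f := v) (fun w hw =>
    hv.differentiableAt (isOpen_ball.mem_nhds (ball_subset_ball (by linarith) hw))) hderiv hc hz
  rw [mem_ball, dist_eq_norm] at hz
  calc ‖v z - v c‖ ≤ 768 / R * ‖z - c‖ := this
    _ ≤ 768 / R * (R / 2) := by gcongr
    _ = 384 := by field_simp; norm_num

/-- A function on a disc which omits `0` and `1` is `exp (2πi cosh² v)` with `v` holomorphic. First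
`F = exp (2πi u)`, where `u` omits the integers; then `v` is a logarithm of `√u + √(u - 1)`, whose
inverse is `√u - √(u - 1)`. The branches are chosen such that `v c` is controlled by `F c`. -/
lemma exists_cosh_lift {F : ℂ → ℂ} {c : ℂ} {R : ℝ} (hR : 0 < R)
    (hF : DifferentiableOn ℂ F (ball c R)) (h0 : ∀ z ∈ ball c R, F z ≠ 0)
    (h1 : ∀ z ∈ ball c R, F z ≠ 1) {M : ℝ} (hM : 1 ≤ M) (hl : M⁻¹ ≤ ‖F c‖) (hu : ‖F c‖ ≤ M) :
    ∃ v : ℂ → ℂ, DifferentiableOn ℂ v (ball c R) ∧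
      (∀ z ∈ ball c R, F z = Complex.exp (2 * Real.pi * Complex.I * Complex.cosh (v z) ^ 2)) ∧
      ‖v c‖ ≤ 2 * Real.log M + 9 := by
  have hc : c ∈ ball c R := mem_ball_self hR
  have hpi := Real.pi_gt_three
  have hpi4 := Real.pi_le_four
  have hlogM : 0 ≤ Real.log M := Real.log_nonneg hM
  obtain ⟨U, hU, hUc, hUe⟩ := exists_log_on_ball hR hF h0 (Complex.exp_log (h0 c hc))
  set u : ℂ → ℂ := fun z => U z / (2 * Real.pi * Complex.I) with hudef
  have hue : ∀ z, 2 * Real.pi * Complex.I * u z = U z := fun z =>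
    mul_div_cancel₀ _ Complex.two_pi_I_ne_zero
  have hud : DifferentiableOn ℂ u (ball c R) := hU.div_const _
  have hun : ∀ z ∈ ball c R, ∀ n : ℤ, u z ≠ n := by
    intro z hz n hn
    refine h1 z hz ?_
    rw [← hUe z hz, ← hue z, hn, mul_comm]
    exact Complex.exp_int_mul_two_pi_mul_I n
  have hu0 : ∀ z ∈ ball c R, u z ≠ 0 := fun z hz => by simpa using hun z hz 0
  have hu1 : ∀ z ∈ ball c R, u z - 1 ≠ 0 := fun z hz h =>
    hun z hz 1 (by simpa using sub_eq_zero.1 h)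
  -- square roots of `u` and of `u - 1`
  have hsqrt : ∀ w : ℂ → ℂ, DifferentiableOn ℂ w (ball c R) → (∀ z ∈ ball c R, w z ≠ 0) →
      ∃ p : ℂ → ℂ, DifferentiableOn ℂ p (ball c R) ∧ ∀ z ∈ ball c R, p z ^ 2 = w z := by
    intro w hw hw0
    obtain ⟨l, hl, -, hle⟩ := exists_log_on_ball hR hw hw0 (Complex.exp_log (hw0 c hc))
    refine ⟨fun z => Complex.exp (l z / 2), (hl.div_const 2).cexp, fun z hz => ?_⟩
    rw [← Complex.exp_nat_mul, ← hle z hz]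
    congr 1; push_cast; ring
  obtain ⟨p, hp, hpu⟩ := hsqrt u hud hu0
  obtain ⟨q, hq, hqu⟩ := hsqrt (fun z => u z - 1) (hud.sub_const 1) hu1
  have hprod : ∀ z ∈ ball c R, (p z + q z) * (p z - q z) = 1 := fun z hz => by
    have h1 := hpu z hz
    have h2 := hqu z hz
    linear_combination h1 - h2
  have hh0 : ∀ z ∈ ball c R, p z + q z ≠ 0 := fun z hz => left_ne_zero_of_mul_eq_one (hprod z hz)
  obtain ⟨v, hv, hvc, hve⟩ := exists_log_on_ball hR (hp.fun_add hq) hh0 (Complex.exp_log (hh0 c hc))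
  refine ⟨v, hv, fun z hz => ?_, ?_⟩
  · have hcosh : Complex.cosh (v z) = p z := by
      have h2 : Complex.exp (-v z) = p z - q z := by
        rw [Complex.exp_neg, hve z hz]
        exact inv_eq_of_mul_eq_one_right (hprod z hz)
      rw [Complex.cosh, h2, hve z hz]
      simp
    rw [hcosh, hpu z hz, hue z, hUe z hz]
  · have hFc : 0 < ‖F c‖ := norm_pos_iff.2 (h0 c hc)
    have hUn : ‖U c‖ ≤ Real.log M + Real.pi := by
      rw [hUc]
      refine (Complex.norm_le_abs_re_add_abs_im _).trans ?_
      rw [Complex.log_re, Complex.log_im]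
      refine add_le_add ?_ (Complex.abs_arg_le_pi _)
      rw [abs_le]
      constructor
      · rw [← Real.log_inv]; exact Real.log_le_log (by positivity) hl
      · exact Real.log_le_log hFc hu
    have hun : ‖u c‖ ≤ Real.log M + 1 := by
      have : ‖u c‖ = ‖U c‖ / (2 * Real.pi) := by
        simp [hudef, abs_of_pos Real.pi_pos]
      rw [this, div_le_iff₀ (by positivity)]
      nlinarith
    have hpn : ‖p c‖ ≤ Real.log M + 1 := by
      have := congrArg norm (hpu c hc)
      rw [norm_pow] at this
      nlinarith [norm_nonneg (p c)]
    have hqn : ‖q c‖ ≤ Real.log M + 2 := by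
      have := congrArg norm (hqu c hc)
      rw [norm_pow] at this
      have h3 := norm_sub_le (u c) 1
      rw [norm_one] at h3
      nlinarith [norm_nonneg (q c)]
    have hsum : ‖p c + q c‖ ≤ 2 * Real.log M + 3 := (norm_add_le _ _).trans (by linarith)
    have hdiff : ‖p c - q c‖ ≤ 2 * Real.log M + 3 := (norm_sub_le _ _).trans (by linarith)
    have hinv : ‖p c + q c‖⁻¹ = ‖p c - q c‖ := by
      rw [← norm_inv, inv_eq_of_mul_eq_one_right (hprod c hc)]
    have hpos : 0 < ‖p c + q c‖ := norm_pos_iff.2 (hh0 c hc)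
    rw [hvc]
    refine (Complex.norm_le_abs_re_add_abs_im _).trans ?_
    have him := Complex.abs_arg_le_pi (p c + q c)
    rw [Complex.log_re, Complex.log_im]
    have hre : |Real.log ‖p c + q c‖| ≤ 2 * Real.log M + 3 := by
      rw [abs_le]
      constructor
      · rw [neg_le, ← Real.log_inv, hinv]
        have := Real.log_le_sub_one_of_pos (hinv ▸ inv_pos.2 hpos : 0 < ‖p c - q c‖)
        linarith
      · have := Real.log_le_sub_one_of_pos hpos
        linarith
    have : Real.pi ≤ 4 := hpi4
    linarith

/-- Schottky's theorem: a holomorphic function on a disc which omits `0` and `1` is bounded on the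
disc of half the radius, in terms of its absolute value at the centre. -/
theorem schottky (M : ℝ) :
    ∃ C : ℝ, ∀ (F : ℂ → ℂ) (c : ℂ) (R : ℝ), 0 < R → DifferentiableOn ℂ F (ball c R) →
      (∀ z ∈ ball c R, F z ≠ 0) → (∀ z ∈ ball c R, F z ≠ 1) → ‖F c‖ ≤ M →
      ∀ z ∈ ball c (R / 2), ‖F z‖ ≤ C := by
  have aux : ∀ M : ℝ, 1 ≤ M → ∃ C : ℝ, ∀ (F : ℂ → ℂ) (c : ℂ) (R : ℝ), 0 < R →
      DifferentiableOn ℂ F (ball c R) → (∀ z ∈ ball c R, F z ≠ 0) → (∀ z ∈ ball c R, F z ≠ 1) →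
      M⁻¹ ≤ ‖F c‖ → ‖F c‖ ≤ M → ∀ z ∈ ball c (R / 2), ‖F z‖ ≤ C := by
    intro M hM
    refine ⟨Real.exp (2 * Real.pi * Real.exp (2 * Real.log M + 9 + 384) ^ 2),
      fun F c R hR hF h0 h1 hl hu z hz => ?_⟩
    obtain ⟨v, hv, hFv, hvc⟩ := exists_cosh_lift hR hF h0 h1 hM hl hu
    have hz' : z ∈ ball c R := ball_subset_ball (by linarith) hz
    have hlat := norm_sub_le_of_omits_lattice hR hv (fun w hw n hn => h1 w hw (by
      rw [hFv w hw, hn, mul_comm]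
      exact_mod_cast Complex.exp_int_mul_two_pi_mul_I n)) hz
    have hvz : ‖v z‖ ≤ 2 * Real.log M + 9 + 384 := by
      have := norm_le_norm_add_norm_sub' (v z) (v c)
      linarith
    have hcosh : ‖Complex.cosh (v z)‖ ≤ Real.exp (2 * Real.log M + 9 + 384) := by
      have h2 : ‖Complex.exp (v z)‖ ≤ Real.exp (2 * Real.log M + 9 + 384) :=
        (Complex.norm_exp_le_exp_norm _).trans (Real.exp_le_exp.2 hvz)
      have h3 : ‖Complex.exp (-v z)‖ ≤ Real.exp (2 * Real.log M + 9 + 384) :=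
        (Complex.norm_exp_le_exp_norm _).trans (Real.exp_le_exp.2 (by rwa [norm_neg]))
      rw [Complex.cosh, norm_div, Complex.norm_ofNat]
      have := norm_add_le (Complex.exp (v z)) (Complex.exp (-v z))
      linarith
    rw [hFv z hz']
    refine (Complex.norm_exp_le_exp_norm _).trans (Real.exp_le_exp.2 ?_)
    simp only [norm_mul, norm_pow, Complex.norm_ofNat, Complex.norm_real, Complex.norm_I,
      Real.norm_eq_abs, abs_of_pos Real.pi_pos, mul_one]
    gcongr
  obtain ⟨C₁, hC₁⟩ := aux (max M 2) (le_max_of_le_right one_le_two)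
  obtain ⟨C₂, hC₂⟩ := aux 2 one_le_two
  refine ⟨max C₁ (C₂ + 1), fun F c R hR hF h0 h1 hM z hz => ?_⟩
  rcases le_or_gt (2⁻¹ : ℝ) ‖F c‖ with h | h
  · refine le_max_of_le_left
      (hC₁ F c R hR hF h0 h1 (le_trans ?_ h) (hM.trans (le_max_left _ _)) z hz)
    exact inv_anti₀ two_pos (le_max_right _ _)
  · -- if `F c` is close to `0`, then `1 - F` also omits `0` and `1` and is not small at `c`
    have h2 := norm_sub_norm_le (1 : ℂ) (F c)
    have h3 := norm_sub_le (1 : ℂ) (F c)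
    rw [norm_one] at h2 h3
    have := hC₂ (fun z => 1 - F z) c R hR (hF.const_sub 1)
      (fun z hz h => h1 z hz (sub_eq_zero.1 h).symm) (fun z hz h => h0 z hz (by simpa using h))
      (by linarith) (by linarith) z hz
    refine le_max_of_le_right ?_
    have h4 := norm_sub_le (1 : ℂ) (1 - F z)
    rw [sub_sub_cancel, norm_one] at h4
    linarith

/-- Montel's theorem for uniformly bounded sequences, on the disc of half the radius. -/
theorem montel_of_bounded {F : ℕ → ℂ → ℂ} {c : ℂ} {R C : ℝ} (hR : 0 < R)
    (hF : ∀ k, DifferentiableOn ℂ (F k) (ball c R)) (hC : ∀ k, ∀ z ∈ ball c R, ‖F k z‖ ≤ C) :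
    ∃ s : ℕ → ℕ, StrictMono s ∧ ∃ h : ℂ → ℂ,
      TendstoUniformlyOn (fun k => F (s k)) h atTop (closedBall c (R / 2)) := by
  set B : Set ℂ := closedBall c (R / 2)
  have hBR : B ⊆ ball c R := closedBall_subset_ball (by linarith)
  have hderiv : ∀ k, ∀ w ∈ B, ‖deriv (F k) w‖ ≤ C / (R / 4) := by
    intro k w hw
    have hsub : closedBall w (R / 4) ⊆ ball c R := by
      intro y hy
      rw [mem_closedBall] at hy hw
      have := dist_triangle y w c
      rw [mem_ball]; linarith
    refine Complex.norm_deriv_le_of_forall_mem_sphere_norm_le (by positivity) ?_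
      fun y hy => hC k y (hsub (sphere_subset_closedBall hy))
    exact DifferentiableOn.diffContOnCl fun y hy =>
      ((hF k) y (hsub (closure_ball_subset_closedBall hy))).mono
        ((closure_ball_subset_closedBall).trans hsub)
  have hlip : ∀ k, ∀ x ∈ B, ∀ y ∈ B, ‖F k x - F k y‖ ≤ C / (R / 4) * ‖x - y‖ := by
    intro k x hx y hy
    exact (convex_closedBall c (R / 2)).norm_image_sub_le_of_norm_deriv_le (fun w hw =>
      (hF k).differentiableAt (isOpen_ball.mem_nhds (hBR hw))) (hderiv k) hy hx
  have : CompactSpace B := isCompact_iff_compactSpace.1 (isCompact_closedBall c (R / 2))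
  let G : ℕ → BoundedContinuousFunction B ℂ := fun k => BoundedContinuousFunction.mkOfCompact
    ⟨fun x => F k x, continuousOn_iff_continuous_domRestrict.1 ((hF k).continuousOn.mono hBR)⟩
  have hG : IsCompact (closure (range G)) := by
    refine BoundedContinuousFunction.arzela_ascoli (closedBall 0 C) (isCompact_closedBall _ _) _
      ?_ ?_
    · rintro _ x ⟨k, rfl⟩
      exact mem_closedBall_zero_iff.2 (hC k x (hBR x.2))
    · refine Metric.equicontinuous_of_continuity_modulus (fun t => C / (R / 4) * t) ?_ _ ?_
      · have : Continuous fun t : ℝ => C / (R / 4) * t := by fun_prop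
        simpa using this.tendsto 0
      · rintro x y ⟨_, k, rfl⟩
        have := hlip k x x.2 y y.2
        rw [← dist_eq_norm, ← dist_eq_norm] at this
        exact this
  obtain ⟨h, -, s, hs, hlim⟩ := hG.tendsto_subseq (fun k => subset_closure (mem_range_self k))
  classical
  refine ⟨s, hs, fun z => if hz : z ∈ B then h ⟨z, hz⟩ else 0, ?_⟩
  rw [BoundedContinuousFunction.tendsto_iff_tendstoUniformly] at hlim
  rw [Metric.tendstoUniformlyOn_iff]
  rw [Metric.tendstoUniformly_iff] at hlim
  intro ε hε
  filter_upwards [hlim ε hε] with k hk z hz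
  simp only [hz, dif_pos]
  exact hk ⟨z, hz⟩

/-! ### Dynamics -/

lemma chordalDist_coe_le (z w : ℂ) :
    chordalDist (z : OnePoint ℂ) (w : OnePoint ℂ) ≤ 2 * ‖z - w‖ := by
  change 2 * ‖z - w‖ / (√(1 + ‖z‖ ^ 2) * √(1 + ‖w‖ ^ 2)) ≤ _
  have h : ∀ y : ℂ, 1 ≤ √(1 + ‖y‖ ^ 2) := fun y => Real.one_le_sqrt.2 (by nlinarith [sq_nonneg ‖y‖])
  exact div_le_self (by positivity) (one_le_mul_of_one_le_of_one_le (h z) (h w))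

lemma chordalDist_coe_infty_lt {z : ℂ} {ε : ℝ} (hε : 0 < ε) (hz : 2 / ε < ‖z‖) :
    chordalDist (z : OnePoint ℂ) OnePoint.infty < ε := by
  change 2 / √(1 + ‖z‖ ^ 2) < ε
  have h : ‖z‖ ≤ √(1 + ‖z‖ ^ 2) := Real.le_sqrt_of_sq_le (by linarith)
  rw [div_lt_iff₀ (by positivity)]
  rw [div_lt_iff₀ hε] at hz
  nlinarith

lemma analyticAt_iterate {f : ℂ → ℂ} (hf : IsMeromorphicOnPlane f) {n : ℕ} {z : ℂ}
    (hz : ∀ i < n, ¬ IsPole f (f^[i] z)) : AnalyticAt ℂ f^[n] z := by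
  induction n with
  | zero => exact analyticAt_id
  | succ n ih =>
    rw [Function.iterate_succ']
    exact (hf.analyticAt (hz n n.lt_succ_self)).comp (ih fun i hi => hz i (hi.trans n.lt_succ_self))

lemma IteratesDefinedOn.mono {f : ℂ → ℂ} {V V' : Set ℂ} (h : IteratesDefinedOn f V)
    (hV : V' ⊆ V) : IteratesDefinedOn f V' := fun z hz => h z (hV hz)

/-- Schottky's theorem for the iterates on a set where all of them are defined: they omit `b` and
the pole `a`. The iterate `f^[0]` has to be excluded, since the identity may take the value `b`. -/
lemma schottky_iterate {f : ℂ → ℂ} (hf : IsMeromorphicOnPlane f) {a b : ℂ}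
    (hb : IsOmittedValue f b) (hbp : ¬ IsPole f b) (ha : IsPole f a) {V : Set ℂ}
    (hV : IteratesDefinedOn f V) (M : ℝ) :
    ∃ C : ℝ, ∀ n, 1 ≤ n → ∀ y r, 0 < r → ball y r ⊆ V → ‖f^[n] y‖ ≤ M →
      ∀ z ∈ ball y (r / 2), ‖f^[n] z‖ ≤ C := by
  have hab : a - b ≠ 0 := sub_ne_zero.2 fun h => hbp (h ▸ ha)
  have hab' : 0 < ‖a - b‖ := norm_pos_iff.2 hab
  obtain ⟨C, hC⟩ := schottky ((M + ‖b‖) / ‖a - b‖)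
  refine ⟨C * ‖a - b‖ + ‖b‖, fun n hn y r hr hrV hM z hz => ?_⟩
  have hd : DifferentiableOn ℂ f^[n] (ball y r) := fun w hw =>
    (analyticAt_iterate hf fun i _ => hV w (hrV hw) i).differentiableAt.differentiableWithinAt
  have hnb : ∀ w ∈ ball y r, f^[n] w ≠ b := by
    intro w hw
    obtain ⟨m, rfl⟩ : ∃ m, n = m + 1 := ⟨n - 1, by omega⟩
    rw [Function.iterate_succ_apply']
    exact hb _ (hV w (hrV hw) m)
  have := hC (fun w => (f^[n] w - b) / (a - b)) y r hr ((hd.sub_const b).div_const _)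
    (fun w hw => div_ne_zero (sub_ne_zero.2 (hnb w hw)) hab)
    (fun w hw h => by
      rw [div_eq_one_iff_eq hab, sub_left_inj] at h
      exact hV w (hrV hw) n (h ▸ ha))
    (by
      rw [norm_div]
      gcongr
      exact (norm_sub_le _ _).trans (by gcongr)) z hz
  rw [norm_div, div_le_iff₀ hab'] at this
  have h2 := norm_le_norm_add_norm_sub' (f^[n] z) b
  linarith

/-- Montel's theorem for the iterates: the Fatou set contains each open set on which all iterates
are defined. -/
theorem subset_fatouSet_of_iteratesDefinedOn {f : ℂ → ℂ} (hf : IsMeromorphicOnPlane f) {a b : ℂ}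
    (hb : IsOmittedValue f b) (hbp : ¬ IsPole f b) (ha : IsPole f a) {V : Set ℂ}
    (hVo : IsOpen V) (hV : IteratesDefinedOn f V) : V ⊆ fatouSet f := by
  intro x hx
  obtain ⟨R, hR, hRV⟩ := Metric.isOpen_iff.1 hVo x hx
  have hsub : ∀ r, r ≤ R → ball x r ⊆ V := fun r hr => (ball_subset_ball hr).trans hRV
  refine ⟨ball x (R / 4), isOpen_ball, mem_ball_self (by positivity),
    hV.mono (hsub _ (by linarith)), fun u => ?_⟩
  by_cases h0 : ∃ᶠ k in atTop, u k = 0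
  · obtain ⟨s, hs, hs0⟩ := extraction_of_frequently_atTop h0
    refine ⟨s, hs, fun z => (z : OnePoint ℂ),
      fun K _ _ ε hε => Eventually.of_forall fun k z _ => ?_⟩
    rw [hs0 k]
    refine (chordalDist_coe_le _ _).trans_lt ?_
    simpa using hε
  have h0' : ∀ᶠ k in atTop, 1 ≤ u k := by
    filter_upwards [not_frequently.1 h0] with k hk
    omega
  by_cases hbdd : ∃ M : ℝ, ∃ᶠ k in atTop, ‖f^[u k] x‖ ≤ M
  · obtain ⟨M, hM⟩ := hbdd
    obtain ⟨C, hC⟩ := schottky_iterate hf hb hbp ha hV M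
    obtain ⟨s, hs, hsM⟩ := extraction_of_frequently_atTop (hM.and_eventually h0')
    obtain ⟨t, ht, h, hlim⟩ := montel_of_bounded (F := fun k => f^[u (s k)]) (c := x) (R := R / 2)
      (C := C) (by positivity)
      (fun k w hw => (analyticAt_iterate hf fun i _ =>
        hV w (hsub _ (by linarith) hw) i).differentiableAt.differentiableWithinAt)
      (fun k z hz => hC _ (hsM k).2 x R hR hRV (hsM k).1 z hz)
    refine ⟨s ∘ t, hs.comp ht, fun z => (h z : OnePoint ℂ), fun K _ hK ε hε => ?_⟩
    filter_upwards [Metric.tendstoUniformlyOn_iff.1 hlim (ε / 2) (by positivity)] with k hk z hz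
    have hzB : z ∈ closedBall x (R / 2 / 2) := by
      have := hK hz
      rw [mem_ball] at this
      rw [mem_closedBall]; linarith
    have h1 := hk z hzB
    rw [dist_comm, dist_eq_norm] at h1
    refine (chordalDist_coe_le _ _).trans_lt ?_
    simp only [Function.comp_apply]
    linarith
  · push Not at hbdd
    refine ⟨id, strictMono_id, fun _ => OnePoint.infty, fun K _ hK ε hε => ?_⟩
    obtain ⟨C, hC⟩ := schottky_iterate hf hb hbp ha hV (2 / ε)
    filter_upwards [hbdd C, h0'] with k hk hk1 z hz
    refine chordalDist_coe_infty_lt hε ?_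
    -- a value of moderate size at `z` would bound the value at `x`
    by_contra hle
    have hzx := hK hz
    rw [mem_ball] at hzx
    have := hC (u k) hk1 z (R / 2) (by positivity)
      ((ball_subset_ball' (by linarith)).trans hRV) (not_lt.1 hle) x
      (by rw [mem_ball, dist_comm]; linarith)
    exact absurd hk (not_lt.2 this)

/-- If `f` were constant near `z`, then so would be the entire function `1 / (f - b)` everywhere,
although it vanishes exactly at the poles of `f`. -/
lemma not_eventually_const {f : ℂ → ℂ} (hf : IsMeromorphicOnPlane f) {a b : ℂ}
    (hb : IsOmittedValue f b) (ha : IsPole f a) {z : ℂ} (hz : ¬ IsPole f z) :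
    ¬ ∀ᶠ w in 𝓝 z, f w = f z := by
  intro h
  obtain ⟨g, hg, hg0, hfg⟩ := exists_entire_reciprocal hf hb
  have hga : AnalyticOnNhd ℂ g univ := hg.differentiableOn.analyticOnNhd isOpen_univ
  have hev : g =ᶠ[𝓝 z] fun _ => g z := by
    filter_upwards [h, hg.continuous.continuousAt.eventually_ne fun h => hz ((hg0 z).1 h)]
      with w hw hw0
    rw [hfg z hz, hfg w fun h => hw0 ((hg0 w).2 h)] at hw
    exact inv_injective (add_left_cancel hw)
  have := hga.eqOn_of_preconnected_of_eventuallyEq analyticOnNhd_const isPreconnected_univ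
    (mem_univ z) hev (mem_univ a)
  rw [(hg0 a).2 ha] at this
  exact hz ((hg0 z).1 this.symm)

/-- The Fatou set is forward invariant: the image of an open set on which all iterates are
defined is open, and all iterates are defined on it. -/
lemma apply_mem_fatouSet {f : ℂ → ℂ} (hf : IsMeromorphicOnPlane f) {a b : ℂ}
    (hb : IsOmittedValue f b) (hbp : ¬ IsPole f b) (ha : IsPole f a) {z : ℂ}
    (hz : z ∈ fatouSet f) : f z ∈ fatouSet f := by
  obtain ⟨V, hVo, hzV, hV, -⟩ := hz
  refine subset_fatouSet_of_iteratesDefinedOn hf hb hbp ha (V := f '' V) ?_ ?_ ⟨z, hzV, rfl⟩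
  · rw [isOpen_iff_mem_nhds]
    rintro _ ⟨w, hw, rfl⟩
    exact (hf.analyticAt (hV w hw 0)).eventually_constant_or_nhds_le_map_nhds.resolve_left
      (not_eventually_const hf hb ha (hV w hw 0)) (image_mem_map (hVo.mem_nhds hw))
  · rintro _ ⟨w, hw, rfl⟩ n
    exact hV w hw (n + 1)

lemma isOpen_fatouSet (f : ℂ → ℂ) : IsOpen (fatouSet f) := by
  rw [isOpen_iff_forall_mem_open]
  rintro z ⟨V, hVo, hzV, hV⟩
  exact ⟨V, fun w hw => ⟨V, hVo, hw, hV⟩, hVo, hzV⟩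

lemma not_isPole_of_mem_fatouSet {f : ℂ → ℂ} {z : ℂ} (hz : z ∈ fatouSet f) (n : ℕ) :
    ¬ IsPole f (f^[n] z) := by
  obtain ⟨V, -, hzV, hV, -⟩ := hz
  exact hV z hzV n

lemma isOpen_iterPreimage_one {f : ℂ → ℂ} (hf : IsMeromorphicOnPlane f) {U : Set ℂ}
    (hU : IsOpen U) : IsOpen (iterPreimage f 1 U) := by
  rw [isOpen_iff_mem_nhds]
  intro z hz
  rw [iterPreimage_one] at hz ⊢
  have han := hf.analyticAt hz.1
  filter_upwards [han.eventually_analyticAt, han.continuousAt (hU.mem_nhds hz.2)] with w hw hwU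
  exact ⟨not_lt.2 hw.meromorphicOrderAt_nonneg, hwU⟩

/-- Let `F` act on `D` as a rotation in the coordinate `φ`, whose image `T` is a union of circles
about the origin. Then arbitrarily close to a repelling fixed point on the frontier of `D` there are
points outside `D` which `F` maps into `D`. -/
theorem frequently_notMem_of_repelling {F φ : ℂ → ℂ} {D T : Set ℂ} {z₀ : ℂ}
    (hF : AnalyticAt ℂ F z₀) (hfix : F z₀ = z₀) (hrep : 1 < ‖deriv F z₀‖) (hD : IsOpen D)
    (hz₀ : z₀ ∈ frontier D) (hφ : DifferentiableOn ℂ φ D) (hbij : BijOn φ D T)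
    (hT : ∀ x ∈ T, ∀ y, ‖y‖ = ‖x‖ → y ∈ T) (hrot : ∀ z ∈ D, F z ∈ D → ‖φ (F z)‖ = ‖φ z‖) :
    ∃ᶠ x in 𝓝 z₀, x ∉ D ∧ F x ∈ D := by
  by_contra hcon
  rw [not_frequently] at hcon
  rw [hD.frontier_eq] at hz₀
  have hne : deriv F z₀ ≠ 0 := norm_pos_iff.1 (one_pos.trans hrep)
  have hstrict := hF.hasStrictDerivAt
  set g := hstrict.localInverse F (deriv F z₀) z₀ hne with hg
  have hright : ∀ᶠ w in 𝓝 z₀, F (g w) = w := by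
    have := hstrict.eventually_right_inverse hne
    rwa [hfix] at this
  have hgz : g z₀ = z₀ := by
    have := (hstrict.eventually_left_inverse hne).self_of_nhds
    rwa [hfix] at this
  have hgd : HasDerivAt g (deriv F z₀)⁻¹ z₀ := by
    have := (hstrict.to_localInverse hne).hasDerivAt
    rwa [hfix] at this
  set q : ℝ := ‖deriv F z₀‖⁻¹ with hq
  have hq1 : q < 1 := inv_lt_one_of_one_lt₀ hrep
  have hq0 : 0 < q := inv_pos.2 (one_pos.trans hrep)
  obtain ⟨c, hqc, hc1⟩ := exists_between hq1
  have hc0 : 0 < c := hq0.trans hqc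
  have hcontr : ∀ᶠ w in 𝓝 z₀, ‖g w - z₀‖ ≤ c * ‖w - z₀‖ := by
    filter_upwards [(hasDerivAt_iff_isLittleO.1 hgd).def (sub_pos.2 hqc)] with w hw
    rw [hgz] at hw
    have h1 := norm_le_norm_add_norm_sub' (g w - z₀) ((w - z₀) • (deriv F z₀)⁻¹)
    rw [norm_smul, norm_inv, ← hq] at h1
    linarith
  obtain ⟨δ, hδ, hball⟩ := Metric.eventually_nhds_iff_ball.1 ((hright.and hcontr).and hcon)
  obtain ⟨w₀, hw₀, hw₀D⟩ := mem_closure_iff_nhds.1 hz₀.1 _ (ball_mem_nhds z₀ hδ)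
  -- the backward orbit of `w₀` under the local inverse
  have horbit : ∀ n, g^[n] w₀ ∈ ball z₀ δ ∧ ‖g^[n] w₀ - z₀‖ ≤ c ^ n * ‖w₀ - z₀‖ ∧
      g^[n] w₀ ∈ D ∧ ‖φ (g^[n] w₀)‖ = ‖φ w₀‖ := by
    intro n
    induction n with
    | zero => exact ⟨hw₀, by simp, hw₀D, rfl⟩
    | succ n ih =>
      obtain ⟨h1, h2, h3, h4⟩ := ih
      rw [Function.iterate_succ_apply']
      obtain ⟨⟨h5, h6⟩, -⟩ := hball _ h1
      have h7 : g (g^[n] w₀) ∈ ball z₀ δ := by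
        rw [mem_ball, dist_eq_norm] at h1 ⊢
        nlinarith [norm_nonneg (g^[n] w₀ - z₀)]
      have h8 : g (g^[n] w₀) ∈ D := by
        by_contra h
        exact (hball _ h7).2 ⟨h, by rwa [h5]⟩
      refine ⟨h7, ?_, h8, ?_⟩
      · calc _ ≤ c * ‖g^[n] w₀ - z₀‖ := h6
          _ ≤ c * (c ^ n * ‖w₀ - z₀‖) := by gcongr
          _ = _ := by ring
      · rw [← h4, ← hrot _ h8 (by rwa [h5]), h5]
  have hlim : Tendsto (fun n => g^[n] w₀) atTop (𝓝 z₀) := by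
    rw [tendsto_iff_norm_sub_tendsto_zero]
    refine squeeze_zero (fun _ => norm_nonneg _) (fun n => (horbit n).2.1) ?_
    simpa using (tendsto_pow_atTop_nhds_zero_of_lt_one hc0.le hc1).mul_const ‖w₀ - z₀‖
  obtain ⟨t, ht, s, hs, hst⟩ := (isCompact_sphere (0 : ℂ) ‖φ w₀‖).tendsto_subseq
    (x := fun n => φ (g^[n] w₀)) fun n => mem_sphere_zero_iff_norm.2 (horbit n).2.2.2
  obtain ⟨d, hdD, rfl⟩ := hbij.surjOn (hT _ (hbij.mapsTo hw₀D) t (mem_sphere_zero_iff_norm.1 ht))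
  have hdz : 0 < dist d z₀ := dist_pos.2 fun h => hz₀.2 (h ▸ hdD)
  have hφd : AnalyticAt ℂ φ d := hφ.analyticAt (hD.mem_nhds hdD)
  have hopen : 𝓝 (φ d) ≤ map φ (𝓝 d) := by
    refine hφd.eventually_constant_or_nhds_le_map_nhds.resolve_left fun h => ?_
    have h1 : ∀ᶠ z in 𝓝 d, z = d := by
      filter_upwards [h, hD.mem_nhds hdD] with z hz hzD using hbij.injOn hzD hdD hz
    have h2 := (h1.filter_mono (nhdsWithin_le_nhds (s := {d}ᶜ))).and self_mem_nhdsWithin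
    obtain ⟨z, hz, hz'⟩ := h2.exists
    exact hz' hz
  have hN : D ∩ ball d (dist d z₀ / 2) ∈ 𝓝 d :=
    inter_mem (hD.mem_nhds hdD) (ball_mem_nhds d (by positivity))
  have hev := hst.eventually (hopen (image_mem_map hN))
  have hev' := (hlim.comp hs.tendsto_atTop).eventually (ball_mem_nhds z₀ (half_pos hdz))
  obtain ⟨n, hn1, hn2⟩ := (hev.and hev').exists
  obtain ⟨y, ⟨hyD, hyd⟩, hy⟩ := hn1
  have hyw : y = g^[s n] w₀ := hbij.injOn hyD (horbit _).2.2.1 hy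
  simp only [Function.comp_apply, ← hyw] at hn2
  rw [mem_ball, dist_comm] at hyd
  have := dist_triangle d y z₀
  linarith

lemma iterPreimage_mul_subset {f : ℂ → ℂ} {D : Set ℂ} (hD : IteratesDefinedOn f D) {p k : ℕ}
    (hmap : MapsTo f^[p] D D) (hk : 1 ≤ k) : iterPreimage f p D ⊆ iterPreimage f (p * k) D := by
  rintro z ⟨hz, hzD⟩
  obtain ⟨m, rfl⟩ : ∃ m, k = m + 1 := ⟨k - 1, by omega⟩
  constructor
  · intro i _
    rcases lt_or_ge i p with hi | hi
    · exact hz i hi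
    · obtain ⟨j, rfl⟩ := Nat.exists_eq_add_of_le' hi
      rw [Function.iterate_add_apply]
      exact hD _ hzD j
  · rw [mul_add, mul_one, Function.iterate_add_apply, Function.iterate_mul]
    exact hmap.iterate m hzD

lemma iterPreimage_succ (f : ℂ → ℂ) (n : ℕ) (A : Set ℂ) :
    iterPreimage f (n + 1) A = iterPreimage f 1 (iterPreimage f n A) := by
  ext z
  rw [iterPreimage_one]
  simp only [iterPreimage, mem_ofPred_eq, Function.iterate_succ_apply]
  constructor
  · rintro ⟨h1, h2⟩
    exact ⟨h1 0 n.succ_pos, fun i hi => h1 (i + 1) (Nat.succ_lt_succ hi), h2⟩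
  · rintro ⟨h1, h2, h3⟩
    refine ⟨fun i hi => ?_, h3⟩
    cases i with
    | zero => exact h1
    | succ i => exact h2 i (Nat.lt_of_succ_lt_succ hi)

lemma iterPreimage_mono (f : ℂ → ℂ) (n : ℕ) {A B : Set ℂ} (h : A ⊆ B) :
    iterPreimage f n A ⊆ iterPreimage f n B := fun _ hz => ⟨hz.1, h hz.2⟩

/-- A domain (possibly empty) whose trace on the Fatou set is relatively closed there: no point of the
Fatou set is on its frontier. Fatou components have this property, and so have the components of the
preimage under `f` of such a domain. -/
structure IsFatouDomain (f : ℂ → ℂ) (U : Set ℂ) : Prop where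
  isOpen : IsOpen U
  isPreconnected : IsPreconnected U
  closure_inter_subset : closure U ∩ fatouSet f ⊆ U

lemma IsFatouComponent.isFatouDomain {f : ℂ → ℂ} {D : Set ℂ} (hD : IsFatouComponent f D) :
    IsFatouDomain f D := by
  obtain ⟨z, hz, rfl⟩ := hD
  exact ⟨(isOpen_fatouSet f).connectedComponentIn, isPreconnected_connectedComponentIn,
    fun y hy => mem_connectedComponentIn_of_mem_closure hy.1 hy.2⟩

lemma IsFatouDomain.component_preimage {f : ℂ → ℂ} (hf : IsMeromorphicOnPlane f)
    (hinv : MapsTo f (fatouSet f) (fatouSet f)) {U : Set ℂ} (hU : IsFatouDomain f U) (z : ℂ) :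
    IsFatouDomain f (connectedComponentIn (iterPreimage f 1 U) z) := by
  refine ⟨(isOpen_iterPreimage_one hf hU.isOpen).connectedComponentIn,
    isPreconnected_connectedComponentIn, fun y hy => ?_⟩
  have hyp : ¬ IsPole f y := not_isPole_of_mem_fatouSet hy.2 0
  refine mem_connectedComponentIn_of_mem_closure hy.1 ?_
  rw [iterPreimage_one]
  refine ⟨hyp, hU.closure_inter_subset ⟨?_, hinv hy.2⟩⟩
  have h1 := mem_closure_image (hf.analyticAt hyp).continuousAt hy.1
  refine closure_mono ?_ h1
  rintro _ ⟨w, hw, rfl⟩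
  have := connectedComponentIn_subset _ _ hw
  rw [iterPreimage_one] at this
  exact this.2

/-- The pigeonhole step: points which `f` maps into `U` and which accumulate at `ζ` are frequently
in one and the same component of `f⁻¹(U)`. -/
lemma exists_component_frequently {f : ℂ → ℂ} (hf : IsMeromorphicOnPlane f)
    {b : ℂ} (hb : IsBakerOmittedValue f b) (hp : ∃ a, IsPole f a) (hbF : b ∈ fatouSet f)
    {U : Set ℂ} (hU : IsFatouDomain f U) {ζ : ℂ} (hζ : ¬ IsPole f ζ) {l : Filter ℂ} {h : ℂ → ℂ}
    (hl : Tendsto h l (𝓝 ζ)) {P : ℂ → Prop} (hfr : ∃ᶠ x in l, P x ∧ f (h x) ∈ U) :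
    ∃ z, ∃ᶠ x in l, P x ∧ h x ∈ connectedComponentIn (iterPreimage f 1 U) z := by
  have hbU : b ∉ frontier U := by
    rw [hU.isOpen.frontier_eq]
    exact fun h => h.2 (hU.closure_inter_subset ⟨h.1, hbF⟩)
  obtain ⟨Z, hZ, hev⟩ := exists_finite_meeting_components hf hb
    (not_isPole_of_mem_fatouSet hbF 0) hp hU.isOpen hU.isPreconnected hbU hζ
  by_contra! hcon
  refine hfr ?_
  filter_upwards [hl.eventually hev,
    (eventually_all_finite hZ).2 fun z _ => hcon z] with x hx hxZ hxU
  obtain ⟨z, hzZ, hz⟩ := hx hxU.2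
  exact hxZ z hzZ hxU.1 hz

theorem theorem1p4 (f : ℂ → ℂ) (hf : ClassMS f) (p : ℕ) (D : Set ℂ)
    (hD : IsRotationDomain f p D) (z₀ : ℂ) (hz₀ : IsRepellingPeriodicPoint f p z₀)
    (hz₀D : z₀ ∈ frontier D) :
    ∀ k : ℕ, 1 ≤ k →
      ∃ W : Set ℂ, IsComponentOf W (iterPreimage f (p * k) D) ∧ W ≠ D ∧ z₀ ∈ frontier W := by
  intro k hk
  obtain ⟨⟨hmer, -, hpoles⟩, b, hb, V, hVo, hbV, hV⟩ := hf
  have hpole : ∃ a, IsPole f a := by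
    rcases hpoles with ⟨a, ha, -⟩ | ⟨a, ha, -⟩
    · exact ⟨a, ha⟩
    · exact ⟨a, by rw [Set.ext_iff] at ha; exact (ha a).2 rfl⟩
  obtain ⟨a, ha⟩ := hpole
  have hbp : ¬ IsPole f b := hV b hbV 0
  have hbF : b ∈ fatouSet f :=
    subset_fatouSet_of_iteratesDefinedOn hmer hb.1 hbp ha hVo hV hbV
  have hinv : MapsTo f (fatouSet f) (fatouSet f) := fun z hz =>
    apply_mem_fatouSet hmer hb.1 hbp ha hz
  obtain ⟨⟨-, hDF, hDmap⟩, T, hT, φ, hφ, hbij, θ, -, hrot⟩ : IsPeriodicFatouComponent f p D ∧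
      ∃ T : Set ℂ, (∀ x ∈ T, ∀ y : ℂ, ‖y‖ = ‖x‖ → y ∈ T) ∧
        ConjugateToIrrationalRotation f p D T := by
    rcases hD with ⟨h, hc⟩ | ⟨h, r, -, hc⟩
    · exact ⟨h, _, fun x hx y hy => by simpa [hy] using hx, hc⟩
    · exact ⟨h, _, fun x hx y hy => by simpa [hy] using hx, hc⟩
  have hDdom : IsFatouDomain f D := hDF.isFatouDomain
  have hDdef : IteratesDefinedOn f D := by
    obtain ⟨z, -, rfl⟩ := hDF
    exact fun w hw => not_isPole_of_mem_fatouSet (connectedComponentIn_subset _ _ hw)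
  obtain ⟨-, hdef, hfix, hrep⟩ := hz₀
  have hz₀nD : z₀ ∉ D := by
    rw [hDdom.isOpen.frontier_eq] at hz₀D; exact hz₀D.2
  have hfreq := frequently_notMem_of_repelling (analyticAt_iterate hmer hdef) hfix hrep
    hDdom.isOpen hz₀D hφ hbij hT (fun z hz _ => by
      rw [hrot z hz, norm_mul, Complex.norm_exp]; simp)
  -- follow the cycle of `z₀` backwards, fixing one component in each step
  have hstep : ∀ j ≤ p, ∃ U, IsFatouDomain f U ∧ U ⊆ iterPreimage f j D ∧
      ∃ᶠ x in 𝓝 z₀, x ∉ D ∧ f^[p - j] x ∈ U := by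
    intro j
    induction j with
    | zero => exact fun _ => ⟨D, hDdom, fun z hz => ⟨by simp, hz⟩, hfreq⟩
    | succ j ih =>
      intro hj
      obtain ⟨U, hU, hUD, hfr⟩ := ih (Nat.le_of_succ_le hj)
      obtain ⟨m, hm⟩ : ∃ m, p - j = m + 1 := ⟨p - j - 1, by omega⟩
      have hm' : p - (j + 1) = m := by omega
      simp only [hm, Function.iterate_succ_apply'] at hfr
      obtain ⟨z, hz⟩ := exists_component_frequently hmer hb ⟨a, ha⟩ hbF hU
        (hdef m (by omega))
        (analyticAt_iterate hmer fun i hi => hdef i (by omega)).continuousAt.tendsto hfr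
      refine ⟨_, hU.component_preimage hmer hinv z, ?_, by rwa [hm']⟩
      rw [iterPreimage_succ f j]
      exact (connectedComponentIn_subset _ _).trans (iterPreimage_mono f 1 hUD)
  obtain ⟨U, hU, hUD, hfr⟩ := hstep p le_rfl
  simp only [Nat.sub_self, Function.iterate_zero, id_eq] at hfr
  obtain ⟨y, hyD, hyU⟩ := hfr.exists
  have hUpk : U ⊆ iterPreimage f (p * k) D := hUD.trans (iterPreimage_mul_subset hDdef hDmap hk)
  set W := connectedComponentIn (iterPreimage f (p * k) D) y with hW
  have hUW : U ⊆ W := hU.isPreconnected.subset_connectedComponentIn hyU hUpk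
  refine ⟨W, ⟨y, hUpk hyU, rfl⟩, fun h => hyD (h ▸ hUW hyU), ?_, fun h => ?_⟩
  · exact closure_mono hUW (mem_closure_iff_frequently.2 (hfr.mono fun x hx => hx.2))
  · have h1 := (connectedComponentIn_subset _ _ (interior_subset h)).2
    rw [Function.iterate_mul, Function.iterate_fixed hfix] at h1
    exact hz₀nD h1
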